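/- Let $n\ge 1$ and let $S=\{s_1,\dots,s_n\}$ be a multiset of integers with $1\le s_i\le 2^n$. Put $\Gamma=2^{8n}$, $\Delta=2^{-7n}$ and $y=\sum_{i=1}^n\big(\tfrac{s_i}{\Gamma}+(\tfrac{s_i}{\Gamma})^2\big)$, let $t$ be any real number with $|t-2e^{y/2}|\le\Delta^2$, and put $\tau_L=\tfrac12$ and $$\tau_H=\frac{-3t\Gamma+28+94t}{-4t\Gamma+56+104t}.$$ **The instance.** In the Pandora box problem with non-obligatory inspection there are sealed boxes with costs $c_i$ and independent random values $v_i\ge 0$. A policy (a decision tree) may, at each step, open a sealed box $i$ at cost $c_i$ and see $v_i$; or take a sealed box $i$ without inspection and end with its value; or end with the highest value seen so far ($0$ if there is none). The payoff is the value obtained minus the costs paid, and a policy is optimal if it has the maximum expected payoff. The index $\tau_i$ of box $i$ is the solution of $\mathbb E[(v_i-\tau_i)_+]=c_i$. Consider the instance with $n+2$ boxes $B_1,\dots,B_{n+2}$ in which $v_i$ equals $1$, $\tfrac12$, $0$ with probabilities $p_i$, $q_i$, $r_i=1-p_i-q_i$, where - for $1\le i\le n$: $p_i=q_i=s_i/\Gamma$,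 and $c_i=p_i(1-\tau_i)$ is chosen so that $B_i$ has index $\tau_i=\tau_H+\dfrac{p_i\,p_{n+1}(1-p_{n+2})(\tau_H-\tau_L)}{2p_{n+2}}$; - $p_{n+1}=1/\Gamma$, $q_{n+1}=1-41/\Gamma$, $c_{n+1}=p_{n+1}/2$ (index $\tau_L$); - $p_{n+2}=q_{n+2}=\tfrac18$, $c_{n+2}=\tfrac1{32}$ (index $\tfrac34$). **Normal policies.** A policy is *normal with ordering* $\sigma$ (a permutation of $\{1,\dots,n+2\}$, with $\sigma(k)$ the box at position $k$) if, as long as it sees only the value $0$, it opens $B_{\sigma(1)},B_{\sigma(2)},\dots$ in this order and takes the last box $B_{\sigma(n+2)}$ without inspection when all the others have shown $0$; when it sees the value $1$ it stops at once; and when it sees the value $\tfrac12$ it runs an index-based policy on the remaining sealed boxes with outside option $\tfrac12$ (it opens a sealed box of highest index while that index exceeds the highest value seen, ends with the highest value seen once no sealed index is larger, and never takes a sealed box; in case of equality between indices, or between an index and the highest value seen, any choice is allowed). **Claim.** The instance is low-cost-low-return-support-3: all values lie in $\{0,\tfrac12,1\}$, and for each box $p_i>0$, $c_i>0$, $\mathbb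 E[v_i]<\tfrac12$ and $\tau_i\ge\tfrac12$. It has an optimal policy, and every optimal policy is normal with some ordering. For every ordering $\sigma^*$ of an optimal policy, let $T^*_{\rm Bef}$ and $T^*_{\rm Aft}$ be the sets of $i\in\{1,\dots,n\}$ such that $B_i$ comes before, respectively after, $B_{n+1}$ in $\sigma^*$. Then $S$ can be partitioned into two parts with equal sums if and only if $$\sum_{i\in T^*_{\rm Aft}}p_i=\sum_{i\in T^*_{\rm Bef}}p_i .$$ -/

import Mathlib

noncomputable section

namespace PandoraNOI

/-- An instance of the Pandora box problem with non-obligatory inspection, with finitely supported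
values: box `i` has search cost `cost i`, and its value is drawn, independently of the other boxes,
from the finite set `supp i`, the value `v` having probability `prob i v`. -/
structure Instance (ι : Type) where
  cost : ι → ℝ
  supp : ι → Finset ℝ
  prob : ι → ℝ → ℝ

namespace Instance

variable {ι : Type} (I : Instance ι)

/-- The data are those of a genuine instance: costs and values are nonnegative, and each `prob i`
is a probability distribution on `supp i`. -/
structure IsValid : Prop where
  cost_nonneg : ∀ i, 0 ≤ I.cost i
  value_nonneg : ∀ i, ∀ v ∈ I.supp i, 0 ≤ v
  prob_nonneg : ∀ i, ∀ v ∈ I.supp i, 0 ≤ I.prob i v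
  prob_sum : ∀ i, ∑ v ∈ I.supp i, I.prob i v = 1

/-- The expectation of `f v`, where `v` is the value of box `i`. -/
def expect (i : ι) (f : ℝ → ℝ) : ℝ := ∑ v ∈ I.supp i, I.prob i v * f v

/-- The expected value of box `i`. -/
def mean (i : ι) : ℝ := I.expect i (fun v => v)

/-- The equation `E[(v_i - τ)₊] = c_i` that defines the index. -/
def IsIndex (i : ι) (τ : ℝ) : Prop := I.expect i (fun v => max 0 (v - τ)) = I.cost i

/-- The index of box `i`: the solution `τ` of `E[(v_i - τ)₊] = c_i` (unique when the cost is
positive). -/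
def index (i : ι) : ℝ := Classical.epsilon (I.IsIndex i)

/-- Low-cost-low-return-support-3 instances. -/
structure IsLCLRS3 : Prop extends I.IsValid where
  supp_eq : ∀ i, I.supp i = {0, 1 / 2, 1}
  prob_one_pos : ∀ i, 0 < I.prob i 1
  cost_pos : ∀ i, 0 < I.cost i
  mean_lt : ∀ i, I.mean i < 1 / 2
  half_le_index : ∀ i, 1 / 2 ≤ I.index i

end Instance

/-- A (deterministic) policy, as a decision tree, when the boxes in `R` are still sealed:
quit with the highest value revealed so far (with `0` if there is none); take a sealed box without
inspecting it, and quit; or open a sealed box and continue according to the value it reveals. -/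
inductive Policy {ι : Type} [DecidableEq ι] : Finset ι → Type
  | quit {R : Finset ι} : Policy R
  | take {R : Finset ι} (i : ι) (hi : i ∈ R) : Policy R
  | inspect {R : Finset ι} (i : ι) (hi : i ∈ R) (next : ℝ → Policy (R.erase i)) : Policy R

namespace Policy

variable {ι : Type} [DecidableEq ι] (I : Instance ι)

/-- The expected payoff from here on (value finally taken, minus the costs that are still to be
paid), when `m` is the highest value revealed so far. -/
def payoffFrom : {R : Finset ι} → Policy R → ℝ → ℝ
  | _, quit, m => m
  | _, take i _, _ => I.mean i
  | _, inspect i _ next, m => -I.cost i + I.expect i (fun v => payoffFrom (next v) (max m v))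

/-- The policy is an index-based policy (ties broken in any way) when `m` is the highest value
revealed so far: it opens a sealed box of highest index as long as that index is not below the
highest value revealed, and it takes that value once no sealed box has a larger index. -/
def IsIndexBased : {R : Finset ι} → Policy R → ℝ → Prop
  | R, quit, m => ∀ j ∈ R, I.index j ≤ m
  | _, take _ _, _ => False
  | R, inspect i _ next, m =>
      (∀ j ∈ R, I.index j ≤ I.index i) ∧ m ≤ I.index i ∧
        ∀ v ∈ I.supp i, IsIndexBased (next v) (max m v)

/-- The policy is normal with ordering `l`, for an instance with values `0`, `1/2`, `1`: as long as
it sees only the value `0`, it opens the boxes in the order of the list `l`, and it takes the last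
box of `l` without inspection; when it sees `1`, it ends at once; when it sees `1/2`, it forsakes taking a
box without inspection and runs an index-based policy on the sealed boxes, with the outside option
`1/2`. -/
def IsNormalList : {R : Finset ι} → Policy R → List ι → Prop
  | _, quit, _ => False
  | _, take i _, l => l = [i]
  | _, inspect i _ next, l => ∃ l' : List ι, l = i :: l' ∧
      next 1 = quit ∧ IsIndexBased I (next (1 / 2)) (1 / 2) ∧ IsNormalList (next 0) l'

/-- The policy maximizes the expected payoff (all boxes are sealed at the start). -/
def IsOptimal (I : Instance ι) [Fintype ι] (A : Policy (Finset.univ : Finset ι)) : Prop :=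
  ∀ B : Policy (Finset.univ : Finset ι), B.payoffFrom I 0 ≤ A.payoffFrom I 0

/-- The policy is normal with ordering `σ`, where `σ k` is the box at position `k`. -/
def IsNormal {N : ℕ} (I : Instance (Fin N)) (A : Policy (Finset.univ : Finset (Fin N)))
    (σ : Equiv.Perm (Fin N)) : Prop :=
  A.IsNormalList I (List.ofFn σ)

end Policy

/-- The integers `s` can be partitioned into two parts with equal sums. -/
def IsYesInstance {n : ℕ} (s : Fin n → ℕ) : Prop :=
  ∃ S : Finset (Fin n), ∑ i ∈ S, s i = ∑ i ∈ Sᶜ, s i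

namespace Reduction

variable {n : ℕ} (s : Fin n → ℕ) (t : ℝ)

/-- `Γ = 2 ^ (8 n)` -/
def Gam (n : ℕ) : ℝ := 2 ^ (8 * n)

/-- `Δ = 2 ^ (- 7 n)` -/
def Del (n : ℕ) : ℝ := (2 ^ (7 * n))⁻¹

/-- `y = ∑ i, (s_i / Γ + (s_i / Γ) ^ 2)` -/
def y : ℝ := ∑ i, ((s i : ℝ) / Gam n + ((s i : ℝ) / Gam n) ^ 2)

/-- `τ_L`, which is the index of box `n + 1` -/
def tauL : ℝ := 1 / 2

/-- `τ_H`, as a function of the parameter `t` -/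
def tauH (n : ℕ) (t : ℝ) : ℝ :=
  (-3 * t * Gam n + 28 + 94 * t) / (-4 * t * Gam n + 56 + 104 * t)

/-- Box `i` for `i` in `[n]`, among the `n + 2` boxes. -/
def item (i : Fin n) : Fin (n + 2) := i.castSucc.castSucc

/-- Box `n + 1`. -/
def boxL (n : ℕ) : Fin (n + 2) := (Fin.last n).castSucc

/-- The vector with entry `f i` at box `i` in `[n]`, `a` at box `n + 1` and `b` at box `n + 2`. -/
def vec (f : Fin n → ℝ) (a b : ℝ) : Fin (n + 2) → ℝ :=
  Fin.snoc (α := fun _ => ℝ) (Fin.snoc (α := fun _ => ℝ) f a) b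

/-- The probabilities `p_i` of the value `1`. -/
def p : Fin (n + 2) → ℝ := vec (fun i => (s i : ℝ) / Gam n) (1 / Gam n) (1 / 8)

/-- The probabilities `q_i` of the value `1/2`. -/
def q : Fin (n + 2) → ℝ := vec (fun i => (s i : ℝ) / Gam n) (1 - 41 / Gam n) (1 / 8)

/-- The intended indices `τ_i` of the boxes in `[n]`:
`τ_H + p_i p_{n+1} (1 - p_{n+2}) (τ_H - τ_L) / (2 p_{n+2})`. -/
def tau (i : Fin n) : ℝ :=
  tauH n t + ((s i : ℝ) / Gam n) * (1 / Gam n) * (1 - 1 / 8) * (tauH n t - tauL) / (2 * (1 / 8))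

/-- The costs. In an LCLRS3 instance the index is `1 - c_i / p_i`, so `c_i = p_i (1 - τ_i)`
makes `τ_i` the index of box `i`. -/
def c : Fin (n + 2) → ℝ :=
  vec (fun i => (s i : ℝ) / Gam n * (1 - tau s t i)) (1 / Gam n / 2) (1 / 32)

/-- The instance with `n + 2` boxes constructed from the integers `s` and the parameter `t`. -/
def inst : Instance (Fin (n + 2)) where
  cost := c s t
  supp := fun _ => {0, 1 / 2, 1}
  prob := fun i v =>
    if v = 1 then p s i else if v = 1 / 2 then q s i else if v = 0 then 1 - p s i - q s i else 0

/-- The boxes in `[n]` that come before box `n + 1` in the ordering `σ`. -/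
def bef (σ : Equiv.Perm (Fin (n + 2))) : Finset (Fin n) :=
  {i | σ.symm (item i) < σ.symm (boxL n)}

/-- The boxes in `[n]` that come after box `n + 1` in the ordering `σ`. -/
def aft (σ : Equiv.Perm (Fin (n + 2))) : Finset (Fin n) :=
  {i | σ.symm (boxL n) < σ.symm (item i)}

end Reduction

end PandoraNOI

end

/-!
In an instance with values `0`, `1/2`, `1` in which all boxes have index at least `1/2` and mean
below `1/2`, a policy that has seen `1` has to stop, and a policy that has seen `1/2` has no use for
blind taking and faces Weitzman's problem. The value of the latter is
`cappedMax R (1/2) = E[max(1/2, κ_j : j ∈ R)]`, where `κ_j` is the index of box `j` if the box shows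
`1` and is void otherwise, and it is attained by the index-based policies only
(`payoffFrom_half`). While only zeros have been seen, opening one more box before taking a box
blindly is always profitable, so that an optimal policy is normal (`exists_isNormalList`).

A normal policy with ordering `l` earns `cappedMax univ (1/2) - loss l`. Here `loss` has a term for
each box that is opened while boxes of larger index are still sealed, and one for the box that is
taken blindly, each weighted by the probability that all boxes before it show `0`. An optimal
policy therefore minimizes `loss` (`loss_le_of_isOptimal`).

In the instance at hand write `a = 1/Γ`, and `L`, `M` for the boxes `n + 1`, `n + 2`. Taking `M`
blindly after `L` has shown `0` is cheaper than ending with any other box, so `M` comes last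
(`getLast_eq`). Let `β` and `α` be the sums of the `p_i` over the items before and after `L`. Up to
terms that do not depend on the ordering and terms of third order in `P = α + β`, the loss is a
positive multiple `C` of

  `∏_{Bef} (1 - 2 p_i) / t - ∏_{Bef} (1 - 2 p_i) ∏_{Aft} (1 - p_i) - (1/2) ∑_{Bef} p_i ^ 2`.

The first product comes from opening `L` and the items while the box `M` of larger index is sealed;
its coefficient is `C / t` by the choice of `τ_H` (`coeff_div_t`). The second one comes from the
penalty of `L`, which depends on the items still sealed. The sum of squares is the effect of the
small shifts `τ_i - τ_H`; it cancels the dependence on the individual `p_i ^ 2`. As `1 / t` is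
`1/2 - P / 4` up to `O(P ^ 2)` and the accuracy of `t`, a second-order expansion turns the
expression into a constant plus `(β - P / 2) ^ 2 / 2` (`abs_mainTerm_sub_le`). If `S` can be
partitioned into two parts with equal sums then the sum of `S` is even, so an unbalanced ordering
has `|β - P / 2| ≥ a`, and `a ^ 2 / 2` exceeds all the error terms as soon as `n ≥ 2`; hence a
balanced ordering beats every unbalanced one (`loss_bounds_lt_of_balanced`). For `n = 1` there is no
such partition.
-/

noncomputable section

namespace PandoraNOI

open Finset

/-! ### The capped maximum of a set of boxes -/

namespace Instance

variable {ι : Type} (I : Instance ι)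

theorem expect_eq_of_supp_eq {I : Instance ι} {i : ι} (h : I.supp i = {0, 1 / 2, 1}) (f : ℝ → ℝ) :
    I.expect i f = I.prob i 0 * f 0 + I.prob i (1 / 2) * f (1 / 2) + I.prob i 1 * f 1 := by
  rw [Instance.expect, h, sum_insert (by norm_num), sum_insert (by norm_num), sum_singleton]
  ring

/-- The expectation `E[max(x, max_{j ∈ R} κ_j)]`, where the `κ_j` are independent, and `κ_j` is the
index of box `j` with probability `prob j 1` and is irrelevant otherwise. The sum runs over the set
`S` of the boxes of `R` that show the value `1`. -/
def cappedMax [DecidableEq ι] (R : Finset ι) (x : ℝ) : ℝ :=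
  ∑ S ∈ R.powerset,
    (∏ j ∈ S, I.prob j 1) * (∏ j ∈ R \ S, (1 - I.prob j 1)) * S.fold max x I.index

theorem _root_.Finset.max_fold_max [DecidableEq ι] {f : ι → ℝ} (S : Finset ι) (x y : ℝ) :
    max y (S.fold max x f) = S.fold max (max x y) f := by
  induction S using Finset.induction_on with
  | empty => simp [max_comm]
  | insert a S ha ih => rw [fold_insert ha, fold_insert ha, ← ih, max_left_comm]

variable [DecidableEq ι]

theorem cappedMax_empty (x : ℝ) : I.cappedMax ∅ x = x := by simp [cappedMax]

/-- Condition on whether box `i` shows the value `1`. -/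
theorem cappedMax_insert {i : ι} {R : Finset ι} (hi : i ∉ R) (x : ℝ) :
    I.cappedMax (insert i R) x =
      I.prob i 1 * I.cappedMax R (max x (I.index i)) + (1 - I.prob i 1) * I.cappedMax R x := by
  unfold cappedMax
  rw [sum_powerset_insert hi, add_comm, mul_sum, mul_sum]
  congr 1
  · refine sum_congr rfl fun S hS => ?_
    have hiS : i ∉ S := fun h => hi (mem_powerset.1 hS h)
    rw [prod_insert hiS, fold_insert hiS, max_fold_max, insert_sdiff_insert]
    rw [sdiff_insert_of_notMem hi]
    ring
  · refine sum_congr rfl fun S hS => ?_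
    have hiS : i ∉ S := fun h => hi (mem_powerset.1 hS h)
    rw [insert_sdiff_of_notMem _ hiS, prod_insert (fun h => hi (mem_sdiff.1 h).1)]
    ring

theorem cappedMax_erase {i : ι} {R : Finset ι} (hi : i ∈ R) (x : ℝ) :
    I.cappedMax R x = I.prob i 1 * I.cappedMax (R.erase i) (max x (I.index i)) +
      (1 - I.prob i 1) * I.cappedMax (R.erase i) x := by
  rw [← cappedMax_insert _ (notMem_erase i R), insert_erase hi]

/-- The properties of an instance with values `0`, `1/2`, `1` that the structure of the optimal
policies rests on: all three values have positive probability, the mean is below `1/2`, the index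
lies in `[1/2, 1)`, and the cost is the one that belongs to the index. -/
structure IsRegular : Prop where
  supp_eq : ∀ i, I.supp i = {0, 1 / 2, 1}
  prob_one_pos : ∀ i, 0 < I.prob i 1
  prob_half_pos : ∀ i, 0 < I.prob i (1 / 2)
  prob_zero_pos : ∀ i, 0 < I.prob i 0
  prob_sum : ∀ i, I.prob i 0 + I.prob i (1 / 2) + I.prob i 1 = 1
  mean_lt : ∀ i, I.mean i < 1 / 2
  half_le_index : ∀ i, 1 / 2 ≤ I.index i
  index_lt_one : ∀ i, I.index i < 1
  cost_eq : ∀ i, I.cost i = I.prob i 1 * (1 - I.index i)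

end Instance

namespace Instance.IsRegular

variable {ι : Type} {I : Instance ι} (hI : I.IsRegular)
include hI

theorem prob_one_lt (i : ι) : I.prob i 1 < 1 := by
  linarith [hI.prob_sum i, hI.prob_half_pos i, hI.prob_zero_pos i]

theorem expect_eq (i : ι) (f : ℝ → ℝ) :
    I.expect i f = I.prob i 0 * f 0 + I.prob i (1 / 2) * f (1 / 2) + I.prob i 1 * f 1 :=
  expect_eq_of_supp_eq (hI.supp_eq i) f

theorem mean_eq (i : ι) : I.mean i = I.prob i (1 / 2) / 2 + I.prob i 1 := by
  rw [Instance.mean, hI.expect_eq]; ring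

theorem mean_pos (i : ι) : 0 < I.mean i := by
  rw [hI.mean_eq]; linarith [hI.prob_half_pos i, hI.prob_one_pos i]

theorem cost_pos (i : ι) : 0 < I.cost i := by
  rw [hI.cost_eq]; exact mul_pos (hI.prob_one_pos i) (by linarith [hI.index_lt_one i])

variable [DecidableEq ι]

theorem le_cappedMax (R : Finset ι) (x : ℝ) : x ≤ I.cappedMax R x := by
  induction R using Finset.induction_on generalizing x with
  | empty => rw [cappedMax_empty]
  | insert i R hi ih =>
    rw [cappedMax_insert _ hi]
    have h1 := mul_le_mul_of_nonneg_left ((le_max_left x (I.index i)).trans (ih _))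
      (hI.prob_one_pos i).le
    have h2 := mul_le_mul_of_nonneg_left (ih x) (sub_nonneg.2 (hI.prob_one_lt i).le)
    linarith

theorem prob_mul_le_cappedMax_sub {R : Finset ι} {j : ι} (hj : j ∈ R) (x : ℝ) :
    I.prob j 1 * (I.index j - x) ≤ I.cappedMax R x - x := by
  rw [I.cappedMax_erase hj]
  have h1 := mul_le_mul_of_nonneg_left ((le_max_right x (I.index j)).trans
    (hI.le_cappedMax (R.erase j) _)) (hI.prob_one_pos j).le
  have h2 := mul_le_mul_of_nonneg_left (hI.le_cappedMax (R.erase j) x)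
    (sub_nonneg.2 (hI.prob_one_lt j).le)
  linarith

/-- A union bound: at most the sum of the individual gains over `x`. -/
theorem cappedMax_sub_le (R : Finset ι) (x : ℝ) :
    I.cappedMax R x - x ≤ ∑ j ∈ R, I.prob j 1 * max 0 (I.index j - x) := by
  induction R using Finset.induction_on generalizing x with
  | empty => simp [cappedMax_empty]
  | insert i R hi ih =>
    rw [cappedMax_insert _ hi, sum_insert hi]
    have h0 : max x (I.index i) = x + max 0 (I.index i - x) := by
      rw [← max_add_add_left]; simp
    have h1 := ih (max x (I.index i))
    have h2 : ∑ j ∈ R, I.prob j 1 * max 0 (I.index j - max x (I.index i)) ≤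
        ∑ j ∈ R, I.prob j 1 * max 0 (I.index j - x) :=
      sum_le_sum fun j _ => mul_le_mul_of_nonneg_left
        (max_le_max_left _ (by linarith [le_max_left x (I.index i)])) (hI.prob_one_pos j).le
    have h3 := mul_le_mul_of_nonneg_left (h1.trans h2) (hI.prob_one_pos i).le
    have h4 := mul_le_mul_of_nonneg_left (ih x) (sub_nonneg.2 (hI.prob_one_lt i).le)
    rw [h0] at h3 ⊢
    linarith

theorem cappedMax_eq_self_iff (R : Finset ι) (x : ℝ) :
    I.cappedMax R x = x ↔ ∀ j ∈ R, I.index j ≤ x := by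
  constructor
  · intro h j hj
    have h1 := hI.prob_mul_le_cappedMax_sub hj x
    rw [h, sub_self] at h1
    by_contra! h2
    exact absurd (mul_pos (hI.prob_one_pos j) (sub_pos.2 h2)) (not_lt.2 h1)
  · intro h
    refine le_antisymm ?_ (hI.le_cappedMax R x)
    have h1 := hI.cappedMax_sub_le R x
    rw [sum_eq_zero fun j hj => by rw [max_eq_left (by linarith [h j hj]), mul_zero]] at h1
    linarith

/-! ### Policies after a positive value has been seen -/

theorem payoffFrom_inspect_zero {R : Finset ι} (i : ι) (hi : i ∈ R)
    (next : ℝ → Policy (R.erase i)) :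
    (Policy.inspect i hi next).payoffFrom I 0 = -I.cost i +
      (I.prob i 0 * (next 0).payoffFrom I 0 + I.prob i (1 / 2) * (next (1 / 2)).payoffFrom I (1 / 2)
        + I.prob i 1 * (next 1).payoffFrom I 1) := by
  rw [Policy.payoffFrom, hI.expect_eq]; norm_num

theorem payoffFrom_inspect_half {R : Finset ι} (i : ι) (hi : i ∈ R)
    (next : ℝ → Policy (R.erase i)) :
    (Policy.inspect i hi next).payoffFrom I (1 / 2) = -I.cost i +
      (I.prob i 0 * (next 0).payoffFrom I (1 / 2) +
        I.prob i (1 / 2) * (next (1 / 2)).payoffFrom I (1 / 2)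
        + I.prob i 1 * (next 1).payoffFrom I 1) := by
  rw [Policy.payoffFrom, hI.expect_eq]; norm_num

theorem payoffFrom_one_le {R : Finset ι} (B : Policy R) : B.payoffFrom I 1 ≤ 1 := by
  induction B with
  | quit => simp [Policy.payoffFrom]
  | take i hi => rw [Policy.payoffFrom]; linarith [hI.mean_lt i]
  | inspect i hi next ih =>
    rw [Policy.payoffFrom, hI.expect_eq]
    norm_num
    have h0 := mul_le_mul_of_nonneg_left (ih 0) (hI.prob_zero_pos i).le
    have h1 := mul_le_mul_of_nonneg_left (ih (1 / 2)) (hI.prob_half_pos i).le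
    have h2 := mul_le_mul_of_nonneg_left (ih 1) (hI.prob_one_pos i).le
    norm_num at h1
    linarith [hI.prob_sum i, hI.cost_pos i]

theorem payoffFrom_one_lt {R : Finset ι} {B : Policy R} (hB : B ≠ .quit) :
    B.payoffFrom I 1 < 1 := by
  cases B with
  | quit => exact absurd rfl hB
  | take i hi => rw [Policy.payoffFrom]; linarith [hI.mean_lt i]
  | inspect i hi next =>
    rw [Policy.payoffFrom, hI.expect_eq]
    norm_num
    have h0 := mul_le_mul_of_nonneg_left (hI.payoffFrom_one_le (next 0)) (hI.prob_zero_pos i).le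
    have h1 := mul_le_mul_of_nonneg_left (hI.payoffFrom_one_le (next (1 / 2)))
      (hI.prob_half_pos i).le
    have h2 := mul_le_mul_of_nonneg_left (hI.payoffFrom_one_le (next 1)) (hI.prob_one_pos i).le
    norm_num at h1
    linarith [hI.prob_sum i, hI.cost_pos i]

theorem isIndexBased_one_iff {R : Finset ι} (B : Policy R) :
    B.IsIndexBased I 1 ↔ B = .quit := by
  cases B with
  | quit => simpa [Policy.IsIndexBased] using fun j _ => (hI.index_lt_one j).le
  | take i hi => simp [Policy.IsIndexBased]
  | inspect i hi next =>
    simp only [Policy.IsIndexBased, reduceCtorEq, iff_false]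
    rintro ⟨-, h, -⟩
    linarith [hI.index_lt_one i]

/-- With the outside option `1/2`, taking a sealed box is useless, and the index-based policies are
exactly the optimal ones. -/
theorem payoffFrom_half {R : Finset ι} (B : Policy R) :
    B.payoffFrom I (1 / 2) ≤ I.cappedMax R (1 / 2) ∧
      (B.payoffFrom I (1 / 2) = I.cappedMax R (1 / 2) ↔ B.IsIndexBased I (1 / 2)) := by
  induction B with
  | @quit R =>
    refine ⟨hI.le_cappedMax R _, ?_⟩
    rw [Policy.payoffFrom, Policy.IsIndexBased, eq_comm, hI.cappedMax_eq_self_iff]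
  | @take R i hi =>
    have h : I.mean i < I.cappedMax R (1 / 2) := (hI.mean_lt i).trans_le (hI.le_cappedMax R _)
    rw [Policy.payoffFrom, Policy.IsIndexBased]
    exact ⟨h.le, iff_of_false h.ne id⟩
  | @inspect R i hi next ih =>
    have hp := hI.prob_one_pos i
    have hq := hI.prob_half_pos i
    have hr := hI.prob_zero_pos i
    have hΦ := I.cappedMax_erase hi (1 / 2)
    rw [max_eq_right (hI.half_le_index i)] at hΦ
    have e1 : I.prob i 1 = 1 - I.prob i 0 - I.prob i (1 / 2) := by linarith [hI.prob_sum i]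
    -- The value lost is a nonnegative combination of the loss of opening `i` now and the
    -- losses in the three subtrees.
    have key : I.cappedMax R (1 / 2) - (Policy.inspect i hi next).payoffFrom I (1 / 2) =
        I.prob i 1 * (I.cappedMax (R.erase i) (I.index i) - I.index i) +
        I.prob i 0 * (I.cappedMax (R.erase i) (1 / 2) - (next 0).payoffFrom I (1 / 2)) +
        I.prob i (1 / 2) *
          (I.cappedMax (R.erase i) (1 / 2) - (next (1 / 2)).payoffFrom I (1 / 2)) +
        I.prob i 1 * (1 - (next 1).payoffFrom I 1) := by
      rw [hI.payoffFrom_inspect_half, hΦ, hI.cost_eq, e1]; ring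
    have k1 := mul_nonneg hp.le (sub_nonneg.2 (hI.le_cappedMax (R.erase i) (I.index i)))
    have k2 := mul_nonneg hr.le (sub_nonneg.2 (ih 0).1)
    have k3 := mul_nonneg hq.le (sub_nonneg.2 (ih (1 / 2)).1)
    have k4 := mul_nonneg hp.le (sub_nonneg.2 (hI.payoffFrom_one_le (next 1)))
    refine ⟨by linarith, ?_⟩
    have hIB : (Policy.inspect i hi next).IsIndexBased I (1 / 2) ↔
        (∀ j ∈ R.erase i, I.index j ≤ I.index i) ∧ (next 0).IsIndexBased I (1 / 2) ∧
          (next (1 / 2)).IsIndexBased I (1 / 2) ∧ next 1 = .quit := by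
      rw [Policy.IsIndexBased, hI.supp_eq, ← hI.isIndexBased_one_iff]
      simp only [mem_insert, mem_singleton, forall_eq_or_imp, forall_eq]
      rw [max_eq_left (by norm_num : (0 : ℝ) ≤ 1 / 2), max_self,
        max_eq_right (by norm_num : (1 / 2 : ℝ) ≤ 1)]
      refine ⟨fun h => ⟨fun j hj => h.1 j (mem_of_mem_erase hj), h.2.2⟩,
        fun ⟨h1, h3⟩ => ⟨fun j hj => ?_, hI.half_le_index i, h3⟩⟩
      rcases eq_or_ne j i with rfl | hji
      · exact le_rfl
      · exact h1 j (mem_erase.2 ⟨hji, hj⟩)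
    rw [hIB, ← hI.cappedMax_eq_self_iff, ← (ih 0).2, ← (ih (1 / 2)).2]
    constructor
    · intro h
      rw [h, sub_self] at key
      have z1 := (mul_eq_zero.1 (by linarith : I.prob i 1 *
        (I.cappedMax (R.erase i) (I.index i) - I.index i) = 0)).resolve_left hp.ne'
      have z2 := (mul_eq_zero.1 (by linarith : I.prob i 0 *
        (I.cappedMax (R.erase i) (1 / 2) - (next 0).payoffFrom I (1 / 2)) = 0)).resolve_left hr.ne'
      have z3 := (mul_eq_zero.1 (by linarith : I.prob i (1 / 2) *
        (I.cappedMax (R.erase i) (1 / 2) - (next (1 / 2)).payoffFrom I (1 / 2)) =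
          0)).resolve_left hq.ne'
      have z4 := (mul_eq_zero.1 (by linarith : I.prob i 1 *
        (1 - (next 1).payoffFrom I 1) = 0)).resolve_left hp.ne'
      refine ⟨by linarith, by linarith, by linarith, ?_⟩
      by_contra hne
      linarith [hI.payoffFrom_one_lt hne]
    · rintro ⟨z1, z2, z3, z4⟩
      have h1 : (next 1).payoffFrom I 1 = 1 := by rw [z4, Policy.payoffFrom]
      rw [z1, z2, z3, h1] at key
      linarith

theorem exists_isIndexBased_half (R : Finset ι) :
    ∃ B : Policy R, B.IsIndexBased I (1 / 2) := by
  induction R using Finset.strongInduction with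
  | H R ih =>
    rcases R.eq_empty_or_nonempty with rfl | hR
    · exact ⟨.quit, by simp [Policy.IsIndexBased]⟩
    obtain ⟨i, hi, hmax⟩ := exists_max_image R I.index hR
    obtain ⟨B, hB⟩ := ih _ (erase_ssubset hi)
    refine ⟨.inspect i hi fun v => if v = 1 then .quit else B, ?_⟩
    rw [Policy.IsIndexBased, hI.supp_eq]
    simp only [mem_insert, mem_singleton, forall_eq_or_imp, forall_eq]
    refine ⟨hmax, hI.half_le_index i, ?_, ?_, ?_⟩
    · simpa using hB
    · norm_num at hB ⊢; exact hB
    · rw [max_eq_right (by norm_num), hI.isIndexBased_one_iff]; simp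

end Instance.IsRegular

/-! ### Optimal policies are normal -/

theorem Policy.payoffFrom_of_eq_empty {ι : Type} [DecidableEq ι] (I : Instance ι) {R : Finset ι}
    (hR : R = ∅) (B : Policy R) (m : ℝ) : B.payoffFrom I m = m := by
  cases B with
  | quit => rfl
  | take i hi => simp [hR] at hi
  | inspect i hi next => simp [hR] at hi

theorem Policy.not_isNormalList_nil {ι : Type} [DecidableEq ι] (I : Instance ι) {R : Finset ι}
    (B : Policy R) : ¬ B.IsNormalList I [] := by
  cases B <;> simp [Policy.IsNormalList]

namespace Instance

variable {ι : Type} [DecidableEq ι] (I : Instance ι)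

/-- The amount by which the payoff of a normal policy with ordering `l` falls short of the value
`cappedMax l (1/2)` that is attainable with the outside option `1/2`: opening a box out of the
order of the indices costs something, and so does taking the last box blindly. -/
def loss : List ι → ℝ
  | [] => 0
  | [i] => I.cappedMax {i} (1 / 2) - I.mean i
  | i :: j :: l => I.prob i 1 * (I.cappedMax (j :: l).toFinset (I.index i) - I.index i) +
      I.prob i 0 * loss (j :: l)

theorem loss_singleton (i : ι) : I.loss [i] = I.cappedMax {i} (1 / 2) - I.mean i := rfl

theorem loss_cons (i : ι) {l : List ι} (hl : l ≠ []) :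
    I.loss (i :: l) = I.prob i 1 * (I.cappedMax l.toFinset (I.index i) - I.index i) +
      I.prob i 0 * I.loss l := by
  cases l with
  | nil => exact absurd rfl hl
  | cons j l => rfl

end Instance

namespace Instance.IsRegular

variable {ι : Type} [DecidableEq ι] {I : Instance ι} (hI : I.IsRegular)
include hI

/-- A best policy is found by comparing the finitely many first moves, each followed by a best
policy on the remaining boxes. -/
theorem exists_payoffFrom_max (R : Finset ι) (m : ℝ) :
    ∃ B : Policy R, ∀ B' : Policy R, B'.payoffFrom I m ≤ B.payoffFrom I m := by
  induction R using Finset.strongInduction generalizing m with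
  | H R ih =>
    choose opt hopt using fun i : R => ih (R.erase i) (erase_ssubset i.2)
    let f : Option (R ⊕ R) → Policy R := fun x => match x with
      | none => .quit
      | some (.inl i) => .take i i.2
      | some (.inr i) => .inspect i i.2 fun v => opt i (max m v)
    obtain ⟨x, hx⟩ := Finite.exists_max fun x => (f x).payoffFrom I m
    refine ⟨f x, fun B' => ?_⟩
    cases B' with
    | quit => exact hx none
    | take i hi => exact hx (some (.inl ⟨i, hi⟩))
    | inspect i hi next =>
      refine le_trans ?_ (hx (some (.inr ⟨i, hi⟩)))
      simp only [f, Policy.payoffFrom, hI.expect_eq]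
      have h := fun v => hopt ⟨i, hi⟩ (max m v) (next v)
      have h0 := mul_le_mul_of_nonneg_left (h 0) (hI.prob_zero_pos i).le
      have h1 := mul_le_mul_of_nonneg_left (h (1 / 2)) (hI.prob_half_pos i).le
      have h2 := mul_le_mul_of_nonneg_left (h 1) (hI.prob_one_pos i).le
      exact add_le_add_right (add_le_add (add_le_add h0 h1) h2) _

/-- An optimal policy on a nonempty set of boxes is normal: an improvement in the subtree after any
of the three values would improve the policy, since each value has positive probability. -/
theorem exists_isNormalList {R : Finset ι} (hR : R.Nonempty) (B : Policy R)
    (hB : ∀ B' : Policy R, B'.payoffFrom I 0 ≤ B.payoffFrom I 0) :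
    ∃ l : List ι, l.Nodup ∧ l.toFinset = R ∧ B.IsNormalList I l := by
  induction B with
  | quit =>
    obtain ⟨i, hi⟩ := hR
    have h := hB (.take i hi)
    rw [Policy.payoffFrom, Policy.payoffFrom] at h
    exact absurd h (not_le.2 (hI.mean_pos i))
  | @take R i hi =>
    by_cases hRi : R = {i}
    · exact ⟨[i], List.nodup_singleton i, by simp [hRi], rfl⟩
    · exfalso
      obtain ⟨j, hj, hji⟩ : ∃ j ∈ R, j ≠ i := by
        by_contra! h
        exact hRi (eq_singleton_iff_unique_mem.2 ⟨hi, h⟩)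
      -- Opening `j` first, and taking `i` only if `j` shows `0`, is strictly better.
      have h := hB (.inspect j hj fun v =>
        if v = 0 then .take i (mem_erase.2 ⟨hji.symm, hi⟩) else .quit)
      rw [hI.payoffFrom_inspect_zero] at h
      norm_num [Policy.payoffFrom] at h
      rw [hI.cost_eq, show I.prob j 0 = 1 - I.prob j (1 / 2) - I.prob j 1 by
        linarith [hI.prob_sum j]] at h
      nlinarith [mul_pos (hI.prob_half_pos j) (sub_pos.2 (hI.mean_lt i)),
        mul_pos (hI.prob_one_pos j) (sub_pos.2 ((hI.mean_lt i).trans_le (hI.half_le_index j)))]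
  | @inspect R i hi next ih =>
    have hp := hI.prob_one_pos i
    have hq := hI.prob_half_pos i
    have hr := hI.prob_zero_pos i
    rcases (R.erase i).eq_empty_or_nonempty with he | hne
    · exfalso
      have h := hB (.take i hi)
      rw [hI.payoffFrom_inspect_zero, Policy.payoffFrom_of_eq_empty I he,
        Policy.payoffFrom_of_eq_empty I he, Policy.payoffFrom_of_eq_empty I he,
        Policy.payoffFrom, hI.mean_eq] at h
      linarith [hI.cost_pos i]
    have hB' : ∀ b0 bh b1 : Policy (R.erase i),
        I.prob i 0 * b0.payoffFrom I 0 + I.prob i (1 / 2) * bh.payoffFrom I (1 / 2) +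
          I.prob i 1 * b1.payoffFrom I 1 ≤
        I.prob i 0 * (next 0).payoffFrom I 0 +
          I.prob i (1 / 2) * (next (1 / 2)).payoffFrom I (1 / 2) +
          I.prob i 1 * (next 1).payoffFrom I 1 := by
      intro b0 bh b1
      have h := hB (.inspect i hi fun v => if v = 0 then b0 else if v = 1 then b1 else bh)
      rw [hI.payoffFrom_inspect_zero, hI.payoffFrom_inspect_zero] at h
      norm_num at h ⊢
      linarith
    have h0 : ∀ B' : Policy (R.erase i), B'.payoffFrom I 0 ≤ (next 0).payoffFrom I 0 := by
      intro B'
      have h := hB' B' (next (1 / 2)) (next 1)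
      exact le_of_mul_le_mul_left (by linarith) hr
    obtain ⟨l, hnd, hl, hn⟩ := ih 0 hne h0
    have hil : i ∉ l := fun h => notMem_erase i R (hl ▸ List.mem_toFinset.2 h)
    refine ⟨i :: l, List.nodup_cons.2 ⟨hil, hnd⟩, ?_, l, rfl, ?_, ?_, hn⟩
    · rw [List.toFinset_cons, hl, insert_erase hi]
    · by_contra hne1
      have h := hB' (next 0) (next (1 / 2)) .quit
      have h1 := mul_lt_mul_of_pos_left (hI.payoffFrom_one_lt hne1) hp
      rw [Policy.payoffFrom] at h
      linarith
    · obtain ⟨C, hC⟩ := hI.exists_isIndexBased_half (R.erase i)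
      rw [← (hI.payoffFrom_half _).2] at hC ⊢
      refine le_antisymm (hI.payoffFrom_half _).1 ?_
      have h := hB' (next 0) C (next 1)
      rw [hC] at h
      exact le_of_mul_le_mul_left (by linarith) hq

theorem payoffFrom_of_isNormalList {R : Finset ι} {B : Policy R} {l : List ι} (hnd : l.Nodup)
    (hl : l.toFinset = R) (hB : B.IsNormalList I l) :
    B.payoffFrom I 0 = I.cappedMax R (1 / 2) - I.loss l := by
  induction B generalizing l with
  | quit => exact absurd hB id
  | @take R i hi =>
    rw [Policy.IsNormalList] at hB
    subst hB
    have hR : R = {i} := by simp [← hl]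
    rw [Policy.payoffFrom, loss_singleton, hR]
    ring
  | @inspect R i hi next ih =>
    obtain ⟨l, rfl, h1, h2, h3⟩ := hB
    obtain ⟨hil, hnd⟩ := List.nodup_cons.1 hnd
    have hl' : l.toFinset = R.erase i := by
      rw [← hl, List.toFinset_cons, erase_insert (by simpa using hil)]
    have hne : l ≠ [] := by rintro rfl; exact (next 0).not_isNormalList_nil I h3
    have hΦ := I.cappedMax_erase hi (1 / 2)
    rw [max_eq_right (hI.half_le_index i)] at hΦ
    rw [hI.payoffFrom_inspect_zero, ih 0 hnd hl' h3, (hI.payoffFrom_half _).2.2 h2, h1,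
      Policy.payoffFrom, I.loss_cons i hne, hl', hΦ, hI.cost_eq,
      show I.prob i 1 = 1 - I.prob i 0 - I.prob i (1 / 2) by linarith [hI.prob_sum i]]
    ring

theorem exists_policy_isNormalList {l : List ι} (hnd : l.Nodup) (hne : l ≠ []) {R : Finset ι}
    (hl : l.toFinset = R) : ∃ B : Policy R, B.IsNormalList I l := by
  induction l generalizing R with
  | nil => exact absurd rfl hne
  | cons i l ih =>
    obtain ⟨hil, hnd⟩ := List.nodup_cons.1 hnd
    have hi : i ∈ R := by simp [← hl]
    rcases eq_or_ne l [] with rfl | hne'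
    · exact ⟨.take i hi, rfl⟩
    have hl' : l.toFinset = R.erase i := by
      rw [← hl, List.toFinset_cons, erase_insert (by simpa using hil)]
    obtain ⟨B, hB⟩ := ih hnd hne' hl'
    obtain ⟨C, hC⟩ := hI.exists_isIndexBased_half (R.erase i)
    refine ⟨.inspect i hi fun v => if v = 0 then B else if v = 1 then .quit else C, l, rfl, ?_⟩
    norm_num at hC ⊢
    exact ⟨hC, hB⟩

/-- The ordering of an optimal normal policy has the least loss among all orderings. -/
theorem loss_le_of_isOptimal [Fintype ι] {A : Policy (univ : Finset ι)} (hA : A.IsOptimal I)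
    {l : List ι} (hnd : l.Nodup) (hl : l.toFinset = univ) (hAl : A.IsNormalList I l)
    {l' : List ι} (hnd' : l'.Nodup) (hne' : l' ≠ []) (hl' : l'.toFinset = univ) :
    I.loss l ≤ I.loss l' := by
  obtain ⟨B, hB⟩ := hI.exists_policy_isNormalList hnd' hne' hl'
  have h := hA B
  rw [hI.payoffFrom_of_isNormalList hnd hl hAl, hI.payoffFrom_of_isNormalList hnd' hl' hB] at h
  linarith

end Instance.IsRegular

theorem Instance.IsRegular.exists_isNormal {N : ℕ} {I : Instance (Fin N)} (hI : I.IsRegular)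
    (hN : N ≠ 0) (A : Policy (univ : Finset (Fin N))) (hA : A.IsOptimal I) :
    ∃ σ : Equiv.Perm (Fin N), A.IsNormal I σ := by
  have : Nonempty (Fin N) := ⟨⟨0, Nat.pos_of_ne_zero hN⟩⟩
  obtain ⟨l, hnd, hl, hAl⟩ := hI.exists_isNormalList univ_nonempty A hA
  have hlen : l.length = N := by
    rw [← List.toFinset_card_of_nodup hnd, hl, card_univ, Fintype.card_fin]
  let f : Fin N → Fin N := fun k => l.get (k.cast hlen.symm)
  have hf : Function.Injective f :=
    (List.nodup_iff_injective_get.1 hnd).comp (Fin.cast_injective hlen.symm)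
  refine ⟨Equiv.ofBijective f (Finite.injective_iff_bijective.1 hf), ?_⟩
  rw [Policy.IsNormal]
  convert hAl using 1
  refine List.ext_getElem (by simp [hlen]) fun k h1 h2 => ?_
  simp [f]

/-! ### The loss of an ordering that is split into two parts -/

namespace Instance

variable {ι : Type} [DecidableEq ι] (I : Instance ι)

/-- The part of the loss that is incurred while the boxes of `l` are opened, when the boxes of `T`
follow. -/
def penalty : List ι → Finset ι → ℝ
  | [], _ => 0
  | i :: l, T => I.prob i 1 * (I.cappedMax (l.toFinset ∪ T) (I.index i) - I.index i) +
      I.prob i 0 * penalty l T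

theorem loss_append (l : List ι) {l' : List ι} (hl' : l' ≠ []) :
    I.loss (l ++ l') = I.penalty l l'.toFinset + (l.map (I.prob · 0)).prod * I.loss l' := by
  induction l with
  | nil => simp [penalty]
  | cons i l ih =>
    rw [List.cons_append, I.loss_cons i (by simp [hl']), ih, penalty, List.toFinset_append,
      List.map_cons, List.prod_cons]
    ring

end Instance

namespace Instance.IsRegular

variable {ι : Type} [DecidableEq ι] {I : Instance ι} (hI : I.IsRegular)
include hI

theorem penalty_nonneg (l : List ι) (T : Finset ι) : 0 ≤ I.penalty l T := by
  induction l with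
  | nil => exact le_rfl
  | cons i l ih =>
    exact add_nonneg (mul_nonneg (hI.prob_one_pos i).le (sub_nonneg.2 (hI.le_cappedMax _ _)))
      (mul_nonneg (hI.prob_zero_pos i).le ih)

theorem loss_singleton_eq (i : ι) : I.loss [i] = I.prob i 0 / 2 - I.cost i := by
  rw [loss_singleton, I.cappedMax_erase (mem_singleton_self i), erase_singleton, cappedMax_empty,
    cappedMax_empty, max_eq_right (hI.half_le_index i), hI.mean_eq, hI.cost_eq,
    show I.prob i 1 = 1 - I.prob i 0 - I.prob i (1 / 2) by linarith [hI.prob_sum i]]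
  ring

/-- Whatever the ordering, the box that is taken blindly causes a loss. -/
theorem prod_mul_loss_singleton_le [Fintype ι] {l : List ι} {x : ι} (hnd : (l ++ [x]).Nodup)
    (hl : (l ++ [x]).toFinset = univ) :
    (∏ i ∈ univ.erase x, I.prob i 0) * (I.prob x 0 / 2 - I.cost x) ≤ I.loss (l ++ [x]) := by
  rw [I.loss_append l (by simp), ← hI.loss_singleton_eq]
  have hx : x ∉ l := fun h => by simpa using (List.nodup_append.1 hnd).2.2 x h
  have h : univ.erase x = l.toFinset := by
    rw [← hl, List.toFinset_append]
    ext i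
    by_cases hi : i = x <;> simp [hi, hx]
  rw [h, List.prod_toFinset _ (List.nodup_append.1 hnd).1]
  linarith [hI.penalty_nonneg l [x].toFinset]

end Instance.IsRegular

/-- The weighted sum of the `p_i ^ 2` over a list of boxes, the weight of a box being the
probability that all the boxes before it show `0`. -/
def weightedSq {ι : Type} (p : ι → ℝ) : List ι → ℝ
  | [] => 0
  | i :: l => p i ^ 2 + (1 - 2 * p i) * weightedSq p l

/-- The shape of the instance: a box `L` of index `1/2`, which shows `1` with probability `a` and
`0` with probability `40 a`; a box `M` of index `3/4`; and items, which show `1/2` and `1` with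
equal probability `p_i`, and whose indices `τ + 4 C p_i` are at most `3/4`. With the shift `4 C p_i`
the loss depends, up to third-order terms, on the `p_i ^ 2` only through their sum over all
items. -/
structure Instance.IsGadget {ι : Type} (I : Instance ι) (L M : ι) (a τ C : ℝ) : Prop
    extends I.IsRegular where
  ne : L ≠ M
  a_pos : 0 < a
  half_lt : 1 / 2 < τ
  C_eq : C = 7 / 8 * a * (τ - 1 / 2)
  prob_one_L : I.prob L 1 = a
  prob_zero_L : I.prob L 0 = 40 * a
  index_L : I.index L = 1 / 2
  prob_one_M : I.prob M 1 = 1 / 8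
  prob_zero_M : I.prob M 0 = 3 / 4
  index_M : I.index M = 3 / 4
  prob_half_item : ∀ i, i ≠ L → i ≠ M → I.prob i (1 / 2) = I.prob i 1
  index_item : ∀ i, i ≠ L → i ≠ M → I.index i = τ + 4 * C * I.prob i 1
  index_item_le : ∀ i, i ≠ L → i ≠ M → I.index i ≤ 3 / 4

namespace Instance.IsGadget

variable {ι : Type} {I : Instance ι} {L M : ι} {a τ C : ℝ}
  (hI : I.IsGadget L M a τ C)
include hI

theorem C_pos : 0 < C := by
  rw [hI.C_eq]
  exact mul_pos (mul_pos (by norm_num) hI.a_pos) (sub_pos.2 hI.half_lt)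

theorem prob_zero_item {i : ι} (hL : i ≠ L) (hM : i ≠ M) : I.prob i 0 = 1 - 2 * I.prob i 1 := by
  linarith [hI.prob_sum i, hI.prob_half_item i hL hM]

theorem le_index_item {i : ι} (hL : i ≠ L) (hM : i ≠ M) : τ ≤ I.index i := by
  rw [hI.index_item i hL hM]
  have := mul_pos hI.C_pos (hI.prob_one_pos i)
  linarith

theorem map_prob_zero {l : List ι} (hl : ∀ i ∈ l, i ≠ L ∧ i ≠ M) :
    l.map (I.prob · 0) = l.map fun i => 1 - 2 * I.prob i 1 :=
  List.map_congr_left fun i hi => hI.prob_zero_item (hl i hi).1 (hl i hi).2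

variable [DecidableEq ι]

/-- Only the box `M` is taken into account: the items of larger index that follow are ignored. -/
theorem le_penalty {l : List ι} (hl : ∀ i ∈ l, i ≠ L ∧ i ≠ M) {T : Finset ι} (hT : M ∈ T) :
    (3 / 4 - τ) / 8 * (1 - (l.map fun i => 1 - 2 * I.prob i 1).prod) / 2
      - C / 2 * weightedSq (I.prob · 1) l ≤ I.penalty l T := by
  induction l with
  | nil => simp [weightedSq, penalty]
  | cons i l ih =>
    have hi := hl i List.mem_cons_self
    have ih' := ih fun j hj => hl j (List.mem_cons_of_mem i hj)
    have h1 := hI.prob_mul_le_cappedMax_sub (mem_union_right l.toFinset hT) (I.index i)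
    have h2 := mul_le_mul_of_nonneg_left h1 (hI.prob_one_pos i).le
    have h3 := mul_le_mul_of_nonneg_left ih' (hI.prob_zero_pos i).le
    rw [hI.index_M, hI.prob_one_M] at h2
    rw [hI.prob_zero_item hi.1 hi.2] at h3
    rw [weightedSq, penalty, List.map_cons, List.prod_cons, hI.prob_zero_item hi.1 hi.2]
    rw [hI.index_item i hi.1 hi.2] at h2 ⊢
    linarith

theorem cappedMax_sub_index_le [Fintype ι] {i : ι} (hi : i ≠ L ∧ i ≠ M) (R : Finset ι) :
    I.cappedMax R (I.index i) - I.index i ≤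
      (3 / 4 - I.index i) / 8 + 4 * C * ∑ j ∈ (univ.erase L).erase M, I.prob j 1 ^ 2 := by
  refine (hI.cappedMax_sub_le R _).trans ?_
  have h1 : ∑ j ∈ R, I.prob j 1 * max 0 (I.index j - I.index i) ≤
      ∑ j, I.prob j 1 * max 0 (I.index j - I.index i) :=
    sum_le_sum_of_subset_of_nonneg (subset_univ R) fun j _ _ =>
      mul_nonneg (hI.prob_one_pos j).le (le_max_left _ _)
  refine h1.trans ?_
  rw [← add_sum_erase univ _ (mem_univ L),
    ← add_sum_erase (univ.erase L) _ (mem_erase.2 ⟨hI.ne.symm, mem_univ M⟩), hI.index_L,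
    hI.index_M, hI.prob_one_M, max_eq_left (by linarith [hI.half_le_index i]),
    max_eq_right (by linarith [hI.index_item_le i hi.1 hi.2]), mul_sum]
  have h2 : ∑ j ∈ (univ.erase L).erase M, I.prob j 1 * max 0 (I.index j - I.index i) ≤
      ∑ j ∈ (univ.erase L).erase M, 4 * C * I.prob j 1 ^ 2 := by
    refine sum_le_sum fun j hj => ?_
    simp only [mem_erase, mem_univ, and_true] at hj
    have h3 := hI.le_index_item hi.1 hi.2
    have h4 := mul_pos hI.C_pos (hI.prob_one_pos j)
    have h5 : max 0 (I.index j - I.index i) ≤ 4 * C * I.prob j 1 :=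
      max_le (by linarith) (by rw [hI.index_item j hj.2 hj.1]; linarith)
    have h6 := mul_le_mul_of_nonneg_left h5 (hI.prob_one_pos j).le
    linarith
  linarith

/-- The items of larger index that follow contribute at most `4 C ∑ p_j ^ 2` to each penalty, as an
index exceeds `τ` by `4 C p_j`. -/
theorem penalty_le [Fintype ι] {l : List ι} (hl : ∀ i ∈ l, i ≠ L ∧ i ≠ M) (T : Finset ι) :
    I.penalty l T ≤
      (3 / 4 - τ) / 8 * (1 - (l.map fun i => 1 - 2 * I.prob i 1).prod) / 2
      - C / 2 * weightedSq (I.prob · 1) l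
      + 4 * C * (∑ j ∈ (univ.erase L).erase M, I.prob j 1 ^ 2) * (l.map (I.prob · 1)).sum := by
  induction l with
  | nil => simp [weightedSq, penalty]
  | cons i l ih =>
    have hi := hl i List.mem_cons_self
    have hl' := fun j hj => hl j (List.mem_cons_of_mem i hj)
    have h1 := hI.cappedMax_sub_index_le hi (l.toFinset ∪ T)
    have h2 := mul_le_mul_of_nonneg_left h1 (hI.prob_one_pos i).le
    have h3 := mul_le_mul_of_nonneg_left (ih hl') (hI.prob_zero_pos i).le
    rw [hI.prob_zero_item hi.1 hi.2] at h3
    rw [weightedSq, penalty, List.map_cons, List.map_cons, List.prod_cons, List.sum_cons,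
      hI.prob_zero_item hi.1 hi.2]
    rw [hI.index_item i hi.1 hi.2] at h2 ⊢
    set S := ∑ j ∈ (univ.erase L).erase M, I.prob j 1 ^ 2
    have hS : 0 ≤ S := sum_nonneg fun j _ => sq_nonneg _
    have hsum : 0 ≤ (l.map (I.prob · 1)).sum :=
      List.sum_nonneg (by simpa using fun j _ => (hI.prob_one_pos j).le)
    have h4 := mul_nonneg (hI.prob_one_pos i).le (mul_nonneg (mul_nonneg hI.C_pos.le hS) hsum)
    linarith

theorem le_cappedMax_item {A : Finset ι} (hA : ∀ i ∈ A, i ≠ L ∧ i ≠ M) (x : ℝ) :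
    τ - (τ - x) * ∏ i ∈ A, (1 - I.prob i 1) ≤ I.cappedMax A x := by
  induction A using Finset.induction_on with
  | empty => simp [cappedMax_empty]
  | insert i A hi ih =>
    have hi' := hA i (mem_insert_self i A)
    rw [cappedMax_insert _ hi, prod_insert hi]
    have h1 := mul_le_mul_of_nonneg_left (ih fun j hj => hA j (mem_insert_of_mem hj))
      (sub_nonneg.2 (hI.prob_one_lt i).le)
    have h2 := mul_le_mul_of_nonneg_left ((hI.le_index_item hi'.1 hi'.2).trans
      ((le_max_right x _).trans (hI.le_cappedMax A _))) (hI.prob_one_pos i).le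
    linarith

theorem cappedMax_item_le {A : Finset ι} (hA : ∀ i ∈ A, i ≠ L ∧ i ≠ M) {x : ℝ} (hx : x ≤ τ) :
    I.cappedMax A x ≤
      τ - (τ - x) * ∏ i ∈ A, (1 - I.prob i 1) + 4 * C * ∑ i ∈ A, I.prob i 1 ^ 2 := by
  induction A using Finset.induction_on with
  | empty => simp [cappedMax_empty]
  | insert i A hi ih =>
    have hi' := hA i (mem_insert_self i A)
    have hA' : ∀ j ∈ A, j ≠ L ∧ j ≠ M := fun j hj => hA j (mem_insert_of_mem hj)
    have hτ := hI.le_index_item hi'.1 hi'.2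
    rw [cappedMax_insert _ hi, prod_insert hi, sum_insert hi, max_eq_right (hx.trans hτ)]
    have h1 := mul_le_mul_of_nonneg_left (ih hA') (sub_nonneg.2 (hI.prob_one_lt i).le)
    have h2 : ∑ j ∈ A, I.prob j 1 * max 0 (I.index j - I.index i) ≤
        4 * C * ∑ j ∈ A, I.prob j 1 ^ 2 := by
      rw [mul_sum]
      refine sum_le_sum fun j hj => ?_
      have h4 := mul_pos hI.C_pos (hI.prob_one_pos j)
      have h5 : max 0 (I.index j - I.index i) ≤ 4 * C * I.prob j 1 :=
        max_le (by linarith)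
          (by rw [hI.index_item j (hA' j hj).1 (hA' j hj).2]; linarith)
      have h6 := mul_le_mul_of_nonneg_left h5 (hI.prob_one_pos j).le
      linarith
    have h3 := mul_le_mul_of_nonneg_left ((hI.cappedMax_sub_le A (I.index i)).trans h2)
      (hI.prob_one_pos i).le
    rw [hI.index_item i hi'.1 hi'.2] at h3 ⊢
    linarith

theorem cappedMax_insert_M {A : Finset ι} (hA : ∀ i ∈ A, i ≠ L ∧ i ≠ M) :
    I.cappedMax (insert M A) (1 / 2) = 3 / 32 + 7 / 8 * I.cappedMax A (1 / 2) := by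
  rw [cappedMax_insert _ fun h => (hA M h).2 rfl, hI.index_M, hI.prob_one_M,
    max_eq_right (by norm_num),
    (hI.cappedMax_eq_self_iff A _).2 fun j hj => hI.index_item_le j (hA j hj).1 (hA j hj).2]
  ring

theorem loss_eq {l₁ l₂ : List ι} (h₁ : ∀ i ∈ l₁, i ≠ L ∧ i ≠ M) (h₂ : ∀ i ∈ l₂, i ≠ L ∧ i ≠ M) :
    I.loss (l₁ ++ L :: (l₂ ++ [M])) = I.penalty l₁ (L :: (l₂ ++ [M])).toFinset +
      (l₁.map fun i => 1 - 2 * I.prob i 1).prod *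
        (a * (7 / 8 * I.cappedMax l₂.toFinset (1 / 2) - 13 / 32) + 40 * a * (I.penalty l₂ {M} +
          (l₂.map fun i => 1 - 2 * I.prob i 1).prod * (11 / 32))) := by
  have h3 : (l₂ ++ [M]).toFinset = insert M l₂.toFinset := by
    ext; simp
  rw [I.loss_append l₁ (by simp), I.loss_cons L (by simp), I.loss_append l₂ (by simp), h3,
    hI.index_L, hI.cappedMax_insert_M (by simpa using h₂), hI.prob_one_L, hI.prob_zero_L,
    hI.loss_singleton_eq, hI.cost_eq, hI.index_M, hI.prob_one_M, hI.prob_zero_M,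
    hI.map_prob_zero h₁, hI.map_prob_zero h₂]
  simp only [List.toFinset_cons, List.toFinset_nil, insert_empty_eq]
  ring

omit [DecidableEq ι] in
theorem prod_nonneg_item {l : List ι} (hl : ∀ i ∈ l, i ≠ L ∧ i ≠ M) :
    0 ≤ (l.map fun i => 1 - 2 * I.prob i 1).prod := by
  rw [← hI.map_prob_zero hl]
  exact List.prod_nonneg (by simpa using fun j _ => (hI.prob_zero_pos j).le)

theorem le_loss {l₁ l₂ : List ι} (h₁ : ∀ i ∈ l₁, i ≠ L ∧ i ≠ M) (h₂ : ∀ i ∈ l₂, i ≠ L ∧ i ≠ M)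
    (hnd : l₂.Nodup) :
    (3 / 4 - τ) / 8 * (1 - (l₁.map fun i => 1 - 2 * I.prob i 1).prod) / 2
      - C / 2 * weightedSq (I.prob · 1) l₁ +
      (l₁.map fun i => 1 - 2 * I.prob i 1).prod *
        (a / 32 + C * (1 - (l₂.map fun i => 1 - I.prob i 1).prod) + 40 * a *
          ((3 / 4 - τ) / 8 * (1 - (l₂.map fun i => 1 - 2 * I.prob i 1).prod) / 2
            - C / 2 * weightedSq (I.prob · 1) l₂ +
          (l₂.map fun i => 1 - 2 * I.prob i 1).prod * (11 / 32))) ≤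
      I.loss (l₁ ++ L :: (l₂ ++ [M])) := by
  rw [hI.loss_eq h₁ h₂]
  have e1 := hI.le_penalty h₁ (T := (L :: (l₂ ++ [M])).toFinset) (by simp)
  have e2 := hI.le_penalty h₂ (T := {M}) (by simp)
  have e3 := hI.le_cappedMax_item (A := l₂.toFinset) (by simpa using h₂) (1 / 2)
  rw [List.prod_toFinset _ hnd] at e3
  have e4 := mul_le_mul_of_nonneg_left e3 hI.a_pos.le
  have e5 := mul_le_mul_of_nonneg_left e2 hI.a_pos.le
  refine add_le_add e1 (mul_le_mul_of_nonneg_left ?_ (hI.prod_nonneg_item h₁))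
  rw [hI.C_eq] at e5 ⊢
  linarith

theorem loss_le [Fintype ι] {l₁ l₂ : List ι} (h₁ : ∀ i ∈ l₁, i ≠ L ∧ i ≠ M)
    (h₂ : ∀ i ∈ l₂, i ≠ L ∧ i ≠ M) (hnd : l₂.Nodup) :
    I.loss (l₁ ++ L :: (l₂ ++ [M])) ≤
    (3 / 4 - τ) / 8 * (1 - (l₁.map fun i => 1 - 2 * I.prob i 1).prod) / 2
      - C / 2 * weightedSq (I.prob · 1) l₁
      + 4 * C * (∑ j ∈ (univ.erase L).erase M, I.prob j 1 ^ 2) * (l₁.map (I.prob · 1)).sum +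
      (l₁.map fun i => 1 - 2 * I.prob i 1).prod *
        (a / 32 + C * (1 - (l₂.map fun i => 1 - I.prob i 1).prod) +
          7 / 2 * a * C * (l₂.map fun i => I.prob i 1 ^ 2).sum + 40 * a *
          ((3 / 4 - τ) / 8 * (1 - (l₂.map fun i => 1 - 2 * I.prob i 1).prod) / 2
            - C / 2 * weightedSq (I.prob · 1) l₂
            + 4 * C * (∑ j ∈ (univ.erase L).erase M, I.prob j 1 ^ 2) * (l₂.map (I.prob · 1)).sum +
          (l₂.map fun i => 1 - 2 * I.prob i 1).prod * (11 / 32))) := by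
  rw [hI.loss_eq h₁ h₂]
  have e1 := hI.penalty_le h₁ (L :: (l₂ ++ [M])).toFinset
  have e2 := hI.penalty_le h₂ {M}
  have e3 := hI.cappedMax_item_le (A := l₂.toFinset) (by simpa using h₂) hI.half_lt.le
  rw [List.prod_toFinset _ hnd, List.sum_toFinset _ hnd] at e3
  have e4 := mul_le_mul_of_nonneg_left e3 hI.a_pos.le
  have e5 := mul_le_mul_of_nonneg_left e2 hI.a_pos.le
  refine add_le_add e1 (mul_le_mul_of_nonneg_left ?_ (hI.prod_nonneg_item h₁))
  have hC := hI.C_eq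
  have e6 : C * (1 - (l₂.map fun i => 1 - I.prob i 1).prod) =
    7 / 8 * a * (τ - 1 / 2) * (1 - (l₂.map fun i => 1 - I.prob i 1).prod) := by rw [hC]
  linarith

end Instance.IsGadget

/-! ### Second-order expansions -/

theorem sum_map_sq_le_sq_sum {ι : Type} {f : ι → ℝ} {l : List ι} (hf : ∀ i ∈ l, 0 ≤ f i) :
    (l.map (f · ^ 2)).sum ≤ (l.map f).sum ^ 2 := by
  induction l with
  | nil => simp
  | cons i l ih =>
    have hl : ∀ j ∈ l, 0 ≤ f j := fun j hj => hf j (List.mem_cons_of_mem i hj)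
    have hs : 0 ≤ (l.map f).sum := List.sum_nonneg (by simpa using hl)
    simp only [List.map_cons, List.sum_cons]
    nlinarith [ih hl, mul_nonneg (hf i List.mem_cons_self) hs]

/-- The second-order expansion of `∏ (1 - f i)`, with the second elementary symmetric polynomial
written in terms of power sums. -/
theorem abs_prod_one_sub_sub_le {ι : Type} {f : ι → ℝ} {l : List ι}
    (hf : ∀ i ∈ l, 0 ≤ f i ∧ f i ≤ 1) :
    |(l.map (1 - f ·)).prod -
      (1 - (l.map f).sum + ((l.map f).sum ^ 2 - (l.map (f · ^ 2)).sum) / 2)| ≤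
      (l.map f).sum ^ 3 / 6 := by
  induction l with
  | nil => simp
  | cons i l ih =>
    have hl : ∀ j ∈ l, 0 ≤ f j ∧ f j ≤ 1 := fun j hj => hf j (List.mem_cons_of_mem i hj)
    obtain ⟨h0, h1⟩ := hf i List.mem_cons_self
    have hs : 0 ≤ (l.map f).sum := List.sum_nonneg (by simpa using fun j hj => (hl j hj).1)
    have hq : 0 ≤ (l.map (f · ^ 2)).sum :=
      List.sum_nonneg (by simpa using fun j _ => sq_nonneg (f j))
    have hqs := sum_map_sq_le_sq_sum fun j hj => (hl j hj).1
    have hi := ih hl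
    simp only [List.map_cons, List.sum_cons, List.prod_cons]
    set s := (l.map f).sum
    set q := (l.map (f · ^ 2)).sum
    set x := f i
    set R := (l.map (1 - f ·)).prod
    rw [abs_le] at hi ⊢
    have h2 := mul_le_mul_of_nonneg_left hi.1 (sub_nonneg.2 h1)
    have h3 := mul_le_mul_of_nonneg_left hi.2 (sub_nonneg.2 h1)
    have h4 : 0 ≤ x * (s ^ 3 / 6) := by positivity
    have h5 : 0 ≤ x * q := by positivity
    have h6 : 0 ≤ x * (s ^ 2 - q) := mul_nonneg h0 (by linarith)
    have h7 : 0 ≤ x ^ 2 * s := by positivity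
    have h8 : 0 ≤ x ^ 3 := by positivity
    constructor <;> nlinarith

theorem one_sub_sum_le_prod {ι : Type} {f : ι → ℝ} {l : List ι}
    (hf : ∀ i ∈ l, 0 ≤ f i ∧ f i ≤ 1) :
    1 - (l.map f).sum ≤ (l.map (1 - f ·)).prod ∧ (l.map (1 - f ·)).prod ≤ 1 := by
  induction l with
  | nil => simp
  | cons i l ih =>
    have hl : ∀ j ∈ l, 0 ≤ f j ∧ f j ≤ 1 := fun j hj => hf j (List.mem_cons_of_mem i hj)
    obtain ⟨h0, h1⟩ := hf i List.mem_cons_self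
    have hs : 0 ≤ (l.map f).sum := List.sum_nonneg (by simpa using fun j hj => (hl j hj).1)
    obtain ⟨h2, h3⟩ := ih hl
    simp only [List.map_cons, List.sum_cons, List.prod_cons]
    constructor <;> nlinarith [mul_nonneg h0 hs]

theorem weightedSq_bounds {ι : Type} {p : ι → ℝ} {l : List ι}
    (hp : ∀ i ∈ l, 0 ≤ p i ∧ 2 * p i ≤ 1) :
    (l.map (p · ^ 2)).sum * (1 - 2 * (l.map p).sum) ≤ weightedSq p l ∧
      weightedSq p l ≤ (l.map (p · ^ 2)).sum ∧ 0 ≤ weightedSq p l := by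
  induction l with
  | nil => simp [weightedSq]
  | cons i l ih =>
    have hl : ∀ j ∈ l, 0 ≤ p j ∧ 2 * p j ≤ 1 := fun j hj => hp j (List.mem_cons_of_mem i hj)
    obtain ⟨h0, h1⟩ := hp i List.mem_cons_self
    have hs : 0 ≤ (l.map p).sum := List.sum_nonneg (by simpa using fun j hj => (hl j hj).1)
    have hq : 0 ≤ (l.map (p · ^ 2)).sum :=
      List.sum_nonneg (by simpa using fun j _ => sq_nonneg (p j))
    obtain ⟨h2, h3, h4⟩ := ih hl
    rw [weightedSq]
    simp only [List.map_cons, List.sum_cons]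
    set s := (l.map p).sum
    set q := (l.map (p · ^ 2)).sum
    have h5 := mul_le_mul_of_nonneg_left h2 (sub_nonneg.2 h1)
    have h6 : 0 ≤ p i * (q * s) := by positivity
    have h7 : 0 ≤ p i ^ 2 * s := by positivity
    have h8 : 0 ≤ p i ^ 2 * p i := by positivity
    have h9 := mul_nonneg h0 h4
    have h10 := mul_nonneg (sub_nonneg.2 h1) h4
    refine ⟨by nlinarith, by nlinarith, by nlinarith [sq_nonneg (p i)]⟩

/-- The probabilities collected from a list of items: for the part `l` of an ordering, `s` and `q`
are the sums of the `p i` and of the `p i ^ 2`, `R` and `Q` are the products of the `1 - 2 p i` and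
of the `1 - p i`, and `W` is the weighted sum of squares. The inequalities are those that the
comparison of orderings uses. -/
structure PartBounds (s q R Q W : ℝ) : Prop where
  s_nonneg : 0 ≤ s
  q_nonneg : 0 ≤ q
  q_le : q ≤ s ^ 2
  R_nonneg : 0 ≤ R
  R_le : R ≤ 1
  le_R : 1 - 2 * s ≤ R
  Q_le : Q ≤ 1
  le_Q : 1 - s ≤ Q
  abs_R : |R - (1 - 2 * s + (4 * s ^ 2 - 4 * q) / 2)| ≤ 8 * s ^ 3 / 6
  abs_Q : |Q - (1 - s + (s ^ 2 - q) / 2)| ≤ s ^ 3 / 6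
  W_nonneg : 0 ≤ W
  W_le : W ≤ q
  le_W : q * (1 - 2 * s) ≤ W

theorem partBounds {ι : Type} {p : ι → ℝ} {l : List ι} (hp : ∀ i ∈ l, 0 ≤ p i ∧ 2 * p i ≤ 1) :
    PartBounds (l.map p).sum (l.map (p · ^ 2)).sum (l.map (1 - 2 * p ·)).prod
      (l.map (1 - p ·)).prod (weightedSq p l) := by
  have h2 : ∀ i ∈ l, 0 ≤ 2 * p i ∧ 2 * p i ≤ 1 := fun i hi =>
    ⟨by linarith [(hp i hi).1], (hp i hi).2⟩
  have h1 : ∀ i ∈ l, 0 ≤ p i ∧ p i ≤ 1 := fun i hi =>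
    ⟨(hp i hi).1, by linarith [(hp i hi).1, (hp i hi).2]⟩
  have e1 : (l.map (2 * p ·)).sum = 2 * (l.map p).sum :=
    List.sum_map_mul_left l p 2
  have e2 : (l.map ((2 * p ·) ^ 2)).sum = 4 * (l.map (p · ^ 2)).sum := by
    rw [← List.sum_map_mul_left l (p · ^ 2) 4]
    congr 1
    refine List.map_congr_left fun i _ => ?_
    simp only [Pi.pow_apply]
    ring
  have hR := abs_prod_one_sub_sub_le h2
  have hR' := one_sub_sum_le_prod h2
  have hQ' := one_sub_sum_le_prod h1
  have hW := weightedSq_bounds hp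
  change |_ - (_ - _ + (_ - (l.map ((2 * p ·) ^ 2)).sum) / 2)| ≤ _ at hR
  rw [e1] at hR hR'
  rw [e2] at hR
  refine ⟨List.sum_nonneg (by simpa using fun j hj => (h1 j hj).1),
    List.sum_nonneg (by simpa using fun j _ => sq_nonneg (p j)),
    sum_map_sq_le_sq_sum fun j hj => (h1 j hj).1, ?_, hR'.2, hR'.1, hQ'.2, hQ'.1, ?_,
    abs_prod_one_sub_sub_le h1, hW.2.2, hW.2.1, hW.1⟩
  · exact List.prod_nonneg (by simpa using fun j hj => (hp j hj).2)
  · rw [mul_pow, mul_pow] at hR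
    norm_num at hR
    exact hR

/-- The expansion of the part of the loss that depends on the ordering, up to third-order terms: it
is minimal when the two parts have equal sums. -/
theorem abs_mainTerm_sub_le {β b R Q' W α c R' Q W' u ε : ℝ} (h₁ : PartBounds β b R Q' W)
    (h₂ : PartBounds α c R' Q W') (hP : α + β ≤ 1) (hu : |u - (1 / 2 - (α + β) / 4)| ≤ ε) :
    |R * u - R * Q - W / 2 - (u - 1 + (α + β) + (b + c) / 2 - 5 * (α + β) ^ 2 / 8 +
      (β - (α + β) / 2) ^ 2 / 2)| ≤ 8 * (α + β) ^ 3 + 2 * (α + β) * ε := by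
  obtain ⟨hβ, hb, hb', hR0, hR1, hR2, -, -, hR, -, -, hW1, hW2⟩ := h₁
  obtain ⟨hα, hc, hc', -, -, -, hQ1, hQ2, -, hQ, -, -, -⟩ := h₂
  set r := 1 - 2 * β + (4 * β ^ 2 - 4 * b) / 2 with hr
  set k := 1 - α + (α ^ 2 - c) / 2 with hk
  set P := α + β with hPdef
  have hP0 : 0 ≤ P := by positivity
  have hε : 0 ≤ ε := (abs_nonneg _).trans hu
  have hβP : β ≤ P := by linarith
  have hαP : α ≤ P := by linarith
  have hβ3 : β ^ 3 ≤ P ^ 3 := by gcongr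
  have hα3 : α ^ 3 ≤ P ^ 3 := by gcongr
  -- The error terms, one for each of the expansions.
  have e1 : |(R - r) * (1 / 2 - P / 4)| ≤ 8 * β ^ 3 / 6 * (1 / 2) := by
    rw [abs_mul]
    refine mul_le_mul hR ?_ (abs_nonneg _) (by positivity)
    rw [abs_le]; constructor <;> linarith
  have e2 : |(R - 1) * (u - (1 / 2 - P / 4))| ≤ 2 * P * ε := by
    rw [abs_mul]
    refine mul_le_mul ?_ hu (abs_nonneg _) (by positivity)
    rw [abs_le]; constructor <;> linarith
  have hk1 : |k| ≤ 1 := by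
    rw [abs_le]
    constructor <;> nlinarith
  have e3 : |(R - r) * k| ≤ 8 * β ^ 3 / 6 * 1 := by
    rw [abs_mul]
    exact mul_le_mul hR hk1 (abs_nonneg _) (by positivity)
  have e4 : |R * (Q - k)| ≤ 1 * (α ^ 3 / 6) := by
    rw [abs_mul]
    refine mul_le_mul ?_ hQ (abs_nonneg _) zero_le_one
    rw [abs_le]; constructor <;> linarith
  have e5 : |(b - W) / 2| ≤ P ^ 3 := by
    have h1 : b * β ≤ P ^ 2 * P := by
      refine mul_le_mul (hb'.trans ?_) hβP hβ (by positivity)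
      gcongr
    rw [abs_le]; constructor <;> linarith
  set e := 2 * β ^ 2 - 2 * b with he
  set f := (α ^ 2 - c) / 2 with hf
  have he0 : 0 ≤ e := by linarith
  have hf0 : 0 ≤ f := by linarith
  have hβ2 : β ^ 2 ≤ P ^ 2 := by gcongr
  have hα2 : α ^ 2 ≤ P ^ 2 := by gcongr
  have he1 : e ≤ 2 * P ^ 2 := by linarith
  have hf1 : f ≤ P ^ 2 / 2 := by linarith
  have hPP : P ^ 2 * P ^ 2 ≤ P ^ 3 := by
    have : P ^ 3 * P ≤ P ^ 3 * 1 := mul_le_mul_of_nonneg_left hP (by positivity)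
    linarith
  have e6 : |-(e * P / 4) + 2 * β * f + α * e - e * f| ≤ 3 * P ^ 3 := by
    have h1 : e * P ≤ 2 * P ^ 2 * P := mul_le_mul_of_nonneg_right he1 hP0
    have h2 : β * f ≤ P * (P ^ 2 / 2) := mul_le_mul hβP hf1 hf0 hP0
    have h3 : α * e ≤ P * (2 * P ^ 2) := mul_le_mul hαP he1 he0 hP0
    have h4 : e * f ≤ 2 * P ^ 2 * (P ^ 2 / 2) := mul_le_mul he1 hf1 hf0 (by positivity)
    have h5 := mul_nonneg he0 hP0
    have h6 := mul_nonneg hβ hf0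
    have h7 := mul_nonneg hα he0
    have h8 := mul_nonneg he0 hf0
    rw [abs_le]; constructor <;> linarith
  have key : R * u - R * Q - W / 2 - (u - 1 + P + (b + c) / 2 - 5 * P ^ 2 / 8 +
      (β - P / 2) ^ 2 / 2) = (R - r) * (1 / 2 - P / 4) + (R - 1) * (u - (1 / 2 - P / 4))
      - (R - r) * k - R * (Q - k) + (b - W) / 2
      + (-(e * P / 4) + 2 * β * f + α * e - e * f) := by
    rw [hr, hk, he, hf, hPdef]; ring
  rw [key]
  rw [abs_le] at e1 e2 e3 e4 e5 e6 ⊢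
  constructor <;> linarith

/-! ### Comparison of two orderings -/

/-- The upper bound for the loss of a balanced ordering (with primes) is below the lower bound for
the loss of an unbalanced one. -/
theorem loss_bounds_lt_of_balanced
    {a τ C u P d β b R₁ Q₁ W₁ α c R₂ Q₂ W₂ β' b' R₁' Q₁' W₁' α' c' R₂' Q₂' W₂' : ℝ}
    (h₁ : PartBounds β b R₁ Q₁ W₁) (h₂ : PartBounds α c R₂ Q₂ W₂)
    (h₁' : PartBounds β' b' R₁' Q₁' W₁') (h₂' : PartBounds α' c' R₂' Q₂' W₂')
    (hP : α + β = P) (hP' : α' + β' = P) (hbc : b' + c' = b + c) (hR : R₁' * R₂' = R₁ * R₂)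
    (hC0 : 0 < C) (hC : -((3 / 4 - τ) / 8) / 2 + a / 32 + C + 20 * a * ((3 / 4 - τ) / 8) = C * u)
    (ha0 : 0 < a) (ha : a ≤ 1 / 1000) (hu : |u - (1 / 2 - P / 4)| ≤ 5 / 4 * P ^ 2 + d)
    (hP1 : P ≤ 1) (hP3 : 128 * P ^ 3 ≤ a ^ 2) (haP : 1024 * (a * P ^ 2) ≤ a ^ 2)
    (hPd : 256 * (P * d) ≤ a ^ 2)
    (hbal : β' = α') (hunbal : 2 * a ≤ |β - α|) :
    (3 / 4 - τ) / 8 * (1 - R₁') / 2 - C / 2 * W₁' + 4 * C * (b' + c') * β' +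
      R₁' * (a / 32 + C * (1 - Q₂') + 7 / 2 * a * C * c' + 40 * a *
        ((3 / 4 - τ) / 8 * (1 - R₂') / 2 - C / 2 * W₂' + 4 * C * (b' + c') * α' +
          R₂' * (11 / 32))) <
    (3 / 4 - τ) / 8 * (1 - R₁) / 2 - C / 2 * W₁ +
      R₁ * (a / 32 + C * (1 - Q₂) + 40 * a *
        ((3 / 4 - τ) / 8 * (1 - R₂) / 2 - C / 2 * W₂ + R₂ * (11 / 32))) := by
  have m := abs_mainTerm_sub_le h₁ h₂ (hP.trans_le hP1) (hP.symm ▸ hu)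
  have m' := abs_mainTerm_sub_le h₁' h₂' (hP'.trans_le hP1) (hP'.symm ▸ hu)
  rw [hP] at m
  rw [hP', hbc] at m'
  obtain ⟨hβ, hb, hb2, hR0, hR1, -, -, -, -, -, -, -, -⟩ := h₁
  obtain ⟨hα, hc, hc2, -, -, -, -, -, -, -, hW0, hW2, -⟩ := h₂
  obtain ⟨hβ', hb', hb2', hR0', hR1', -, -, -, -, -, -, -, -⟩ := h₁'
  obtain ⟨hα', hc', hc2', -, -, -, -, -, -, -, hW0', -, -⟩ := h₂'
  have hP0 : 0 ≤ P := by linarith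
  have hs : b + c ≤ P ^ 2 := by rw [← hP]; linarith [mul_nonneg hα hβ]
  -- The separation: half the square of the deviation from the balanced sum.
  have sep : a ^ 2 / 2 ≤ (β - P / 2) ^ 2 / 2 := by
    have h : (2 * a) ^ 2 ≤ (β - α) ^ 2 := by
      rw [← sq_abs (β - α)]; gcongr
    rw [show β - P / 2 = (β - α) / 2 by rw [← hP]; ring]
    linarith
  have sep' : β' - P / 2 = 0 := by rw [← hP', hbal]; ring
  rw [sep'] at m'
  rw [abs_le] at m m'
  -- The remaining error terms.
  have f1 : (b + c) * β' ≤ P ^ 2 * P := by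
    gcongr; linarith
  have f2 : (b + c) * α' ≤ P ^ 2 * P := by
    gcongr; linarith
  have f3 : R₁ * W₂ ≤ 1 * P ^ 2 := mul_le_mul hR1 (by linarith) hW0 zero_le_one
  have f4 : R₁' * c' ≤ 1 * P ^ 2 := mul_le_mul hR1' (by linarith) hc' zero_le_one
  have f5 : 0 ≤ R₁' * W₂' := mul_nonneg hR0' hW0'
  have f6 : R₁' * ((b + c) * α') ≤ 1 * (P ^ 2 * P) :=
    mul_le_mul hR1' f2 (mul_nonneg (add_nonneg hb hc) hα') zero_le_one
  have g3 := mul_le_mul_of_nonneg_left f3 ha0.le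
  have g4 := mul_le_mul_of_nonneg_left f4 ha0.le
  have g5 := mul_nonneg ha0.le f5
  have g6 := mul_le_mul_of_nonneg_left f6 ha0.le
  have g7 : a * P ^ 3 ≤ 1 / 1000 * P ^ 3 := by gcongr
  have ha2 : 0 < a ^ 2 := by positivity
  have main : 0 < C * ((R₁ * u - R₁ * Q₂ - W₁ / 2) - (R₁' * u - R₁' * Q₂' - W₁' / 2)
      - 20 * (a * (R₁ * W₂)) + 20 * (a * (R₁' * W₂')) - 4 * ((b + c) * β')
      - 7 / 2 * (a * (R₁' * c')) - 160 * (a * (R₁' * ((b + c) * α')))) := by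
    refine mul_pos hC0 ?_
    linarith
  rw [hbc]
  have hCR : R₁ * (C * u) = R₁ * (-((3 / 4 - τ) / 8) / 2 + a / 32 + C +
    20 * a * ((3 / 4 - τ) / 8)) := by rw [hC]
  have hCR' : R₁' * (C * u) = R₁' * (-((3 / 4 - τ) / 8) / 2 + a / 32 + C +
    20 * a * ((3 / 4 - τ) / 8)) := by rw [hC]
  have hRa : a * (R₁' * R₂') = a * (R₁ * R₂) := by rw [hR]
  have hRτ : a * τ * (R₁' * R₂') = a * τ * (R₁ * R₂) := by rw [hR]
  linarith

/-- The leading terms of the loss of an ordering with `M` in the last place are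
 `a / 32`, for opening `L` before `M`, and `40 a * (11 / 32)`, for taking `M` blindly. -/
theorem loss_bound_le_of_small {a τ C P β b R₁ Q₁ W₁ α c R₂ Q₂ W₂ : ℝ}
    (h₁ : PartBounds β b R₁ Q₁ W₁) (h₂ : PartBounds α c R₂ Q₂ W₂)
    (hP : α + β = P) (ha0 : 0 < a) (ha : a ≤ 1 / 1000) (hP1 : P ≤ 1 / 1000)
    (hC0 : 0 < C) (hC1 : C ≤ a) (hτ0 : τ ≤ 3 / 4) (hτ1 : 3 / 4 - τ ≤ 8 * a) :
    (3 / 4 - τ) / 8 * (1 - R₁) / 2 - C / 2 * W₁ + 4 * C * (b + c) * β +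
      R₁ * (a / 32 + C * (1 - Q₂) + 7 / 2 * a * C * c + 40 * a *
        ((3 / 4 - τ) / 8 * (1 - R₂) / 2 - C / 2 * W₂ + 4 * C * (b + c) * α +
          R₂ * (11 / 32))) ≤ 14 * a := by
  obtain ⟨hβ, hb, hb2, hR0, hR1, hR2, -, -, -, -, hW0, -, -⟩ := h₁
  obtain ⟨hα, hc, hc2, hS0, hS1, hS2, hQ1, hQ2, -, -, hV0, -, -⟩ := h₂
  set k := (3 / 4 - τ) / 8 with hk
  have hk0 : 0 ≤ k := by linarith
  have hka : k ≤ a := by linarith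
  have hP0 : 0 ≤ P := by linarith
  have hs : b + c ≤ 1 / 1000 := by
    have : b + c ≤ P ^ 2 := by rw [← hP]; linarith [mul_nonneg hα hβ]
    nlinarith
  have e1 : k * (1 - R₁) ≤ a * (1 / 500) := mul_le_mul hka (by linarith) (by linarith) ha0.le
  have e2 : k * (1 - R₂) ≤ a * (1 / 500) := mul_le_mul hka (by linarith) (by linarith) ha0.le
  have e3 : C * ((b + c) * β) ≤ a * (1 / 1000 * (1 / 1000)) := by
    gcongr; linarith
  have e4 : C * ((b + c) * α) ≤ a * (1 / 1000 * (1 / 1000)) := by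
    gcongr; linarith
  have e5 : C * (1 - Q₂) ≤ a * (1 / 1000) := mul_le_mul hC1 (by linarith) (by linarith) ha0.le
  have e6 : C * c ≤ a * (1 / 1000) := mul_le_mul hC1 (by linarith) hc ha0.le
  have e7 : a * (C * c) ≤ a * (1 / 1000 * (1 / 1000)) := by
    refine mul_le_mul_of_nonneg_left (e6.trans ?_) ha0.le
    linarith
  have e8 := mul_nonneg hC0.le hW0
  have e9 := mul_nonneg hC0.le hV0
  have e10 : k * (1 - R₂) / 2 - C / 2 * W₂ + 4 * C * (b + c) * α + R₂ * (11 / 32) ≤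
      a * (1 / 1000) + 4 * (a * (1 / 1000 * (1 / 1000))) + 11 / 32 := by linarith
  have e11 : k * (1 - R₂) / 2 - C / 2 * W₂ + 4 * C * (b + c) * α + R₂ * (11 / 32) ≤
      11 / 32 + 1 / 10000 := by linarith
  have e12 := mul_le_mul_of_nonneg_left e11 ha0.le
  have e13 : R₁ * (a / 32 + C * (1 - Q₂) + 7 / 2 * a * C * c + 40 * a *
      (k * (1 - R₂) / 2 - C / 2 * W₂ + 4 * C * (b + c) * α + R₂ * (11 / 32))) ≤
      1 * (a * (1 / 32 + 1 / 1000 + 1 / 1000 + 40 * (11 / 32 + 1 / 10000))) := by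
    refine (mul_le_mul_of_nonneg_left ?_ hR0).trans (mul_le_mul_of_nonneg_right hR1 (by positivity))
    linarith
  linarith

/-! ### The optimal ordering of the gadget -/

namespace Instance.IsGadget

variable {ι : Type} {I : Instance ι} {L M : ι} {a τ C : ℝ}
  (hI : I.IsGadget L M a τ C)
include hI

theorem partBounds {l : List ι} (hl : ∀ i ∈ l, i ≠ L ∧ i ≠ M) :
    PartBounds (l.map (I.prob · 1)).sum (l.map (I.prob · 1 ^ 2)).sum
      (l.map (1 - 2 * I.prob · 1)).prod (l.map (1 - I.prob · 1)).prod
      (weightedSq (I.prob · 1) l) :=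
  PandoraNOI.partBounds fun i hi => ⟨(hI.prob_one_pos i).le, by
    linarith [hI.prob_zero_item (hl i hi).1 (hl i hi).2, hI.prob_zero_pos i]⟩

variable [DecidableEq ι] [Fintype ι]

theorem prod_prob_zero :
    ∏ i, I.prob i 0 = 30 * a * ∏ i ∈ (univ.erase L).erase M, (1 - 2 * I.prob i 1) := by
  rw [← mul_prod_erase univ _ (mem_univ L),
    ← mul_prod_erase (univ.erase L) _ (mem_erase.2 ⟨hI.ne.symm, mem_univ M⟩), hI.prob_zero_L,
    hI.prob_zero_M, prod_congr rfl fun i hi => hI.prob_zero_item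
      (ne_of_mem_erase (mem_of_mem_erase hi)) (ne_of_mem_erase hi)]
  ring

/-- An ordering with the least loss ends with the box `M`: with any other last box, the blind choice
at the end is too expensive. -/
theorem getLast_eq {P : ℝ} (hP : ∑ i ∈ (univ.erase L).erase M, I.prob i 1 = P)
    (hP1 : P ≤ 1 / 1000) {l : List ι} {x : ι} (hnd : (l ++ [x]).Nodup)
    (hl : (l ++ [x]).toFinset = univ) (h : I.loss (l ++ [x]) ≤ 14 * a) : x = M := by
  by_contra hx
  have h1 := hI.prod_mul_loss_singleton_le hnd hl
  have hr := hI.prob_zero_pos x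
  have ha := hI.a_pos
  have hprod : (∏ i ∈ univ.erase x, I.prob i 0) * I.prob x 0 =
      30 * a * ∏ i ∈ (univ.erase L).erase M, (1 - 2 * I.prob i 1) := by
    rw [prod_erase_mul univ _ (mem_univ x), hI.prod_prob_zero]
  have hpos : 0 < ∏ i ∈ univ.erase x, I.prob i 0 := prod_pos fun i _ => hI.prob_zero_pos i
  have hρ : 1 - 2 * P ≤ ∏ i ∈ (univ.erase L).erase M, (1 - 2 * I.prob i 1) := by
    have h2 := hI.partBounds (l := ((univ.erase L).erase M).toList) (by simp [and_comm])
    have h3 := h2.le_R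
    rw [Finset.sum_map_toList, Finset.prod_map_toList, hP] at h3
    exact h3
  have hP0 : 0 ≤ P := hP ▸ sum_nonneg fun i _ => (hI.prob_one_pos i).le
  have h4 : I.prob x 0 * (39 / 80) ≤ I.prob x 0 / 2 - I.cost x := by
    rw [hI.cost_eq]
    by_cases hxL : x = L
    · rw [hxL, hI.prob_zero_L, hI.prob_one_L, hI.index_L]; linarith
    · have hxP : I.prob x 1 ≤ P := hP ▸ single_le_sum (f := (I.prob · 1))
        (fun i _ => (hI.prob_one_pos i).le) (mem_erase.2 ⟨hx, mem_erase.2 ⟨hxL, mem_univ x⟩⟩)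
      have := mul_le_mul_of_nonneg_left (hI.half_le_index x) (hI.prob_one_pos x).le
      rw [hI.prob_zero_item hxL hx]
      linarith
  have h5 := mul_le_mul_of_nonneg_left h4 hpos.le
  rw [← mul_assoc, hprod] at h5
  have h6 := mul_le_mul_of_nonneg_left hρ ha.le
  have h7 := mul_le_mul_of_nonneg_left hP1 ha.le
  linarith

/-- If the items can be split into two parts with equal sums of the `p_i`, then an ordering with the
least loss opens one such part before `L` and the other one after it. -/
theorem sum_eq_of_loss_minimal {u P d : ℝ}
    (hP : ∑ i ∈ (univ.erase L).erase M, I.prob i 1 = P)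
    (hC : -((3 / 4 - τ) / 8) / 2 + a / 32 + C + 20 * a * ((3 / 4 - τ) / 8) = C * u)
    (hCa : C ≤ a) (hτ0 : τ ≤ 3 / 4) (hτ1 : 3 / 4 - τ ≤ 8 * a) (ha : a ≤ 1 / 1000)
    (hu : |u - (1 / 2 - P / 4)| ≤ 5 / 4 * P ^ 2 + d) (hP1 : P ≤ 1 / 1000)
    (hP3 : 128 * P ^ 3 ≤ a ^ 2) (haP : 1024 * (a * P ^ 2) ≤ a ^ 2) (hPd : 256 * (P * d) ≤ a ^ 2)
    (hgap : ∀ S ⊆ (univ.erase L).erase M,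
      ∑ i ∈ S, I.prob i 1 ≠ ∑ i ∈ (univ.erase L).erase M \ S, I.prob i 1 →
      2 * a ≤ |∑ i ∈ S, I.prob i 1 - ∑ i ∈ (univ.erase L).erase M \ S, I.prob i 1|)
    (hyes : ∃ S ⊆ (univ.erase L).erase M,
      ∑ i ∈ S, I.prob i 1 = ∑ i ∈ (univ.erase L).erase M \ S, I.prob i 1)
    {l : List ι} (hnd : l.Nodup) (hl : l.toFinset = univ)
    (hmin : ∀ l' : List ι, l'.Nodup → l' ≠ [] → l'.toFinset = univ → I.loss l ≤ I.loss l') :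
    ∃ l₁ l₂ : List ι, l = l₁ ++ L :: (l₂ ++ [M]) ∧
      (l₁.map (I.prob · 1)).sum = (l₂.map (I.prob · 1)).sum := by
  set T := (univ.erase L).erase M with hT
  have hTmem : ∀ i, i ∈ T ↔ i ≠ L ∧ i ≠ M := fun i => by simp [hT, and_comm]
  -- Sums and products over two lists that together enumerate the items.
  have hsplit : ∀ l₁ l₂ : List ι, (l₁ ++ l₂).Nodup → (l₁ ++ l₂).toFinset = T → ∀ f : ι → ℝ,
      (l₂.map f).sum + (l₁.map f).sum = ∑ i ∈ T, f i := by
    intro l₁ l₂ h1 h2 f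
    rw [← h2, List.sum_toFinset f h1, List.map_append, List.sum_append, add_comm]
  have hsplit' : ∀ l₁ l₂ : List ι, (l₁ ++ l₂).Nodup → (l₁ ++ l₂).toFinset = T → ∀ f : ι → ℝ,
      (l₁.map f).prod * (l₂.map f).prod = ∏ i ∈ T, f i := by
    intro l₁ l₂ h1 h2 f
    rw [← h2, List.prod_toFinset f h1, List.map_append, List.prod_append]
  have hitem : ∀ l₁ l₂ : List ι, (l₁ ++ l₂).toFinset = T →
      (∀ i ∈ l₁, i ≠ L ∧ i ≠ M) ∧ ∀ i ∈ l₂, i ≠ L ∧ i ≠ M := by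
    intro l₁ l₂ h2
    constructor <;> intro i hi <;> rw [← hTmem, ← h2] <;> simp [hi]
  -- The ordering to compare with.
  obtain ⟨S, hST, hS⟩ := hyes
  set k₁ := S.toList with hk₁
  set k₂ := (T \ S).toList with hk₂
  have hknd : (k₁ ++ k₂).Nodup := by
    refine List.nodup_append'.2 ⟨S.nodup_toList, (T \ S).nodup_toList, fun i h1 h2 => ?_⟩
    rw [hk₁, mem_toList] at h1
    rw [hk₂, mem_toList, mem_sdiff] at h2
    exact h2.2 h1
  have hkT : (k₁ ++ k₂).toFinset = T := by
    rw [List.toFinset_append, hk₁, hk₂, toList_toFinset, toList_toFinset,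
      union_sdiff_of_subset hST]
  obtain ⟨hi₁, hi₂⟩ := hitem k₁ k₂ hkT
  have hk0nd : (k₁ ++ L :: (k₂ ++ [M])).Nodup := by
    rw [List.nodup_middle, ← List.append_assoc, List.nodup_cons, List.nodup_append']
    refine ⟨?_, hknd, List.nodup_singleton M, ?_⟩
    · simp only [List.mem_append, List.mem_singleton, not_or]
      exact ⟨⟨fun h => (hi₁ L h).1 rfl, fun h => (hi₂ L h).1 rfl⟩, hI.ne⟩
    · rw [List.disjoint_singleton, List.mem_append, not_or]
      exact ⟨fun h => (hi₁ M h).2 rfl, fun h => (hi₂ M h).2 rfl⟩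
  have hk0 : (k₁ ++ L :: (k₂ ++ [M])).toFinset = univ := by
    refine eq_univ_of_forall fun i => ?_
    have h := hTmem i
    rw [← hkT] at h
    simp only [List.mem_toFinset, List.mem_append, List.mem_cons] at h ⊢
    tauto
  have hmin' := hmin _ hk0nd (by simp) hk0
  have hub := hI.loss_le hi₁ hi₂ (List.nodup_append'.1 hknd).2.1
  rw [← hT, ← hsplit k₁ k₂ hknd hkT (I.prob · 1 ^ 2),
    add_comm (k₂.map fun i => I.prob i 1 ^ 2).sum] at hub
  have hb₁ := hI.partBounds hi₁
  have hb₂ := hI.partBounds hi₂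
  have hkP := hsplit k₁ k₂ hknd hkT (I.prob · 1)
  rw [hP] at hkP
  have hsmall := loss_bound_le_of_small hb₁ hb₂ hkP hI.a_pos ha hP1 hI.C_pos hCa hτ0 hτ1
  -- The last box is `M`.
  obtain ⟨l', x, rfl⟩ : ∃ l' x, l = l' ++ [x] := by
    rcases List.eq_nil_or_concat l with rfl | ⟨l', x, h⟩
    · exact absurd (hl.symm ▸ mem_univ L : L ∈ ([] : List ι).toFinset) (by simp)
    · exact ⟨l', x, h.trans List.concat_eq_append⟩
  obtain rfl := hI.getLast_eq hP hP1 hnd hl (by linarith)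
  have hLl : L ∈ l' := by
    have h : L ∈ (l' ++ [x]).toFinset := hl.symm ▸ mem_univ L
    simpa [hI.ne] using h
  obtain ⟨l₁, l₂, rfl⟩ := List.append_of_mem hLl
  rw [List.append_assoc, List.cons_append] at hnd hl hmin' ⊢
  refine ⟨l₁, l₂, rfl, ?_⟩
  have hnd' := hnd
  rw [List.nodup_middle, ← List.append_assoc, List.nodup_cons, List.nodup_append'] at hnd'
  obtain ⟨hL, hlnd, -, hM⟩ := hnd'
  have hlT : (l₁ ++ l₂).toFinset = T := by
    ext i
    have h : i ∈ (l₁ ++ L :: (l₂ ++ [x])).toFinset := hl.symm ▸ mem_univ i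
    rw [hTmem]
    simp only [List.mem_toFinset, List.mem_append, List.mem_cons, List.not_mem_nil, or_false,
      List.disjoint_singleton] at h hL hM ⊢
    constructor
    · intro hi
      refine ⟨?_, ?_⟩ <;> rintro rfl <;> tauto
    · tauto
  obtain ⟨hj₁, hj₂⟩ := hitem l₁ l₂ hlT
  have hlP := hsplit l₁ l₂ hlnd hlT (I.prob · 1)
  rw [hP] at hlP
  by_contra hne
  obtain ⟨hnd₁, hnd₂, hdisj⟩ := List.nodup_append'.1 hlnd
  have hl₂ : T \ l₁.toFinset = l₂.toFinset := by
    rw [← hlT, List.toFinset_append, union_sdiff_cancel_left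
      (List.disjoint_toFinset_iff_disjoint.2 hdisj)]
  have hgap' := hgap l₁.toFinset (hlT ▸ by simp)
  rw [hl₂, List.sum_toFinset _ hnd₁, List.sum_toFinset _ hnd₂] at hgap'
  have hbal : (k₁.map (I.prob · 1)).sum = (k₂.map (I.prob · 1)).sum := by
    rw [hk₁, hk₂, Finset.sum_map_toList, Finset.sum_map_toList, hS]
  have hlt := loss_bounds_lt_of_balanced (hI.partBounds hj₁) (hI.partBounds hj₂) hb₁ hb₂ hlP hkP
    (by rw [add_comm, hsplit k₁ k₂ hknd hkT (I.prob · 1 ^ 2), add_comm,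
      hsplit l₁ l₂ hlnd hlT (I.prob · 1 ^ 2)])
    (by rw [hsplit' k₁ k₂ hknd hkT, hsplit' l₁ l₂ hlnd hlT]) hI.C_pos hC hI.a_pos ha hu
    (by linarith) hP3 haP hPd hbal (hgap' hne)
  have hlb := hI.le_loss hj₁ hj₂ hnd₂
  linarith

end Instance.IsGadget

/-! ### The boxes of the instance -/

namespace Instance

variable {ι : Type} {I : Instance ι}

theorem index_eq {i : ι} {τ : ℝ} (h : I.supp i = {0, 1 / 2, 1}) (hp : 0 < I.prob i 1)
    (hq : 0 ≤ I.prob i (1 / 2)) (hr : 0 ≤ I.prob i 0) (hτ : 1 / 2 ≤ τ) (hτ1 : τ < 1)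
    (hc : I.cost i = I.prob i 1 * (1 - τ)) : I.index i = τ := by
  have hτi : I.IsIndex i τ := by
    rw [IsIndex, expect_eq_of_supp_eq h, hc, max_eq_left (by linarith), max_eq_left (by linarith),
      max_eq_right (by linarith)]
    ring
  have hi : I.IsIndex i (I.index i) := Classical.epsilon_spec ⟨τ, hτi⟩
  rw [IsIndex, expect_eq_of_supp_eq h, hc] at hi
  rcases lt_trichotomy (I.index i) τ with hlt | heq | hgt
  · have h0 := mul_nonneg hr (le_max_left 0 (0 - I.index i))
    have h1 := mul_nonneg hq (le_max_left 0 (1 / 2 - I.index i))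
    have h2 := mul_le_mul_of_nonneg_left (le_max_right 0 (1 - I.index i)) hp.le
    have h3 := mul_lt_mul_of_pos_left hlt hp
    linarith
  · exact heq
  · rw [max_eq_left (by linarith), max_eq_left (by linarith)] at hi
    have h2 : max 0 (1 - I.index i) < 1 - τ := max_lt (by linarith) (by linarith)
    have h3 := mul_lt_mul_of_pos_left h2 hp
    linarith

end Instance

namespace Reduction

variable {n : ℕ} (s : Fin n → ℕ) (t : ℝ)

/-- Box `n + 2`. -/
def boxM (n : ℕ) : Fin (n + 2) := Fin.last (n + 1)

theorem forall_box {Q : Fin (n + 2) → Prop} :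
    (∀ i, Q i) ↔ (∀ i : Fin n, Q (item i)) ∧ Q (boxL n) ∧ Q (boxM n) := by
  rw [Fin.forall_fin_succ', Fin.forall_fin_succ', and_assoc]
  rfl

theorem vec_item (f : Fin n → ℝ) (x z : ℝ) (i : Fin n) : vec f x z (item i) = f i := by
  simp [vec, item]

theorem vec_boxL (f : Fin n → ℝ) (x z : ℝ) : vec f x z (boxL n) = x := by
  simp [vec, boxL]

theorem vec_boxM (f : Fin n → ℝ) (x z : ℝ) : vec f x z (boxM n) = z := by
  simp [vec, boxM]

theorem item_ne_boxL (i : Fin n) : item i ≠ boxL n := by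
  simp only [item, boxL, ne_eq, Fin.castSucc_inj]
  exact (Fin.castSucc_lt_last i).ne

theorem item_ne_boxM (i : Fin n) : item i ≠ boxM n := (Fin.castSucc_lt_last _).ne

theorem boxL_ne_boxM : boxL n ≠ boxM n := (Fin.castSucc_lt_last _).ne

theorem item_injective : Function.Injective (item (n := n)) :=
  (Fin.castSucc_injective _).comp (Fin.castSucc_injective _)

theorem exists_item {j : Fin (n + 2)} (hL : j ≠ boxL n) (hM : j ≠ boxM n) :
    ∃ i, item i = j := by
  have h : ∀ j : Fin (n + 2), j ≠ boxL n → j ≠ boxM n → ∃ i, item i = j :=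
    forall_box.2 ⟨fun i _ _ => ⟨i, rfl⟩, fun h _ => absurd rfl h, fun _ h => absurd rfl h⟩
  exact h j hL hM

theorem prob_one (i : Fin (n + 2)) : (inst s t).prob i 1 = p s i := by simp [inst]

theorem prob_half (i : Fin (n + 2)) : (inst s t).prob i (1 / 2) = q s i := by
  norm_num [inst]

theorem prob_zero (i : Fin (n + 2)) : (inst s t).prob i 0 = 1 - p s i - q s i := by
  simp [inst]

/-- The sum `∑ p_i` over the boxes in `[n]`. -/
def total : ℝ := ∑ i, (s i : ℝ) / Gam n

/-- The constant `C` of the gadget. -/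
def coeff (n : ℕ) (t : ℝ) : ℝ := 7 / 8 * (1 / Gam n) * (tauH n t - 1 / 2)

/-! ### Numerical bounds for the parameters -/

theorem Gam_eq (n : ℕ) : 1 / Gam n = ((1 / 2) ^ n) ^ 8 := by
  rw [Gam, ← pow_mul, mul_comm n 8, one_div_pow]

theorem Del_sq_eq (n : ℕ) : Del n ^ 2 = ((1 / 2) ^ n) ^ 14 := by
  rw [Del, ← pow_mul, one_div_pow, one_div, inv_pow, ← pow_mul]
  ring_nf

theorem Gam_pos (n : ℕ) : 0 < Gam n := by unfold Gam; positivity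

theorem half_pow_le {m n : ℕ} (h : m ≤ n) : ((1 / 2 : ℝ)) ^ n ≤ (1 / 2) ^ m :=
  pow_le_pow_of_le_one (by norm_num) (by norm_num) h

variable {s t}

theorem total_nonneg : 0 ≤ total s :=
  sum_nonneg fun _ _ => div_nonneg (Nat.cast_nonneg _) (Gam_pos n).le

theorem total_le (hn : 1 ≤ n) (hs : ∀ i, 1 ≤ s i ∧ s i ≤ 2 ^ n) :
    total s ≤ ((1 / 2) ^ n) ^ 6 / 2 := by
  set w : ℝ := (1 / 2) ^ n with hw
  have hw0 : 0 < w := by positivity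
  have h2 : (2 : ℝ) ^ n * w = 1 := by rw [hw, ← mul_pow]; norm_num
  have h1 : ∀ i, (s i : ℝ) / Gam n ≤ w ^ 7 := fun i => by
    have h3 : (s i : ℝ) ≤ 2 ^ n := by exact_mod_cast (hs i).2
    calc (s i : ℝ) / Gam n = s i * w ^ 8 := by rw [div_eq_mul_one_div, Gam_eq]
      _ ≤ 2 ^ n * w ^ 8 := by gcongr
      _ = w ^ 7 := by linear_combination w ^ 7 * h2
  have h3 : (n : ℝ) ≤ 2 ^ n / 2 := by
    have h4 : n ≤ 2 ^ (n - 1) := by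
      have := Nat.lt_two_pow_self (n := n - 1)
      omega
    have h5 : (2 : ℝ) ^ n = 2 ^ (n - 1) * 2 := by rw [← pow_succ, Nat.sub_add_cancel hn]
    rw [h5]
    have h6 : (n : ℝ) ≤ 2 ^ (n - 1) := by exact_mod_cast h4
    linarith
  calc total s ≤ ∑ _ : Fin n, w ^ 7 := sum_le_sum fun i _ => h1 i
    _ = n * w ^ 7 := by simp
    _ ≤ 2 ^ n / 2 * w ^ 7 := by gcongr
    _ = w ^ 6 / 2 := by linear_combination w ^ 6 / 2 * h2

theorem total_le_of_one_le (hn : 1 ≤ n) (hs : ∀ i, 1 ≤ s i ∧ s i ≤ 2 ^ n) :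
    total s ≤ 1 / 128 := by
  have h : ((1 / 2 : ℝ) ^ n) ^ 6 ≤ ((1 / 2) ^ 1) ^ 6 := by
    have := half_pow_le hn
    gcongr
  have := total_le hn hs
  norm_num at h
  linarith

theorem y_bounds : total s ≤ y s ∧ y s ≤ total s + total s ^ 2 := by
  have h : y s = total s + ∑ i, ((s i : ℝ) / Gam n) ^ 2 := sum_add_distrib
  rw [h]
  exact ⟨le_add_of_nonneg_right (sum_nonneg fun i _ => sq_nonneg _), add_le_add_right
    (sum_sq_le_sq_sum_of_nonneg fun i _ => div_nonneg (Nat.cast_nonneg _) (Gam_pos n).le) _⟩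

/-- The parameter `t` agrees with `2 + ∑ p_i` up to second-order terms. -/
theorem abs_t_sub_le (hn : 1 ≤ n) (hs : ∀ i, 1 ≤ s i ∧ s i ≤ 2 ^ n)
    (ht : |t - 2 * Real.exp (y s / 2)| ≤ Del n ^ 2) :
    |t - 2 - total s| ≤ 8 / 5 * total s ^ 2 + ((1 / 2) ^ n) ^ 14 := by
  rw [Del_sq_eq] at ht
  have hP := total_le_of_one_le hn hs
  have hP0 := total_nonneg (s := s)
  obtain ⟨hy0, hy1⟩ := y_bounds (s := s)
  set P := total s
  have hPP : P ^ 2 ≤ 1 / 128 * P := by rw [sq]; gcongr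
  have hexp := Real.abs_exp_sub_one_sub_id_le (x := y s / 2)
    (by rw [abs_of_nonneg (by linarith)]; linarith)
  have hy2 : (y s / 2) ^ 2 ≤ (129 / 256 * P) ^ 2 := by
    have : y s / 2 ≤ 129 / 256 * P := by linarith
    have : 0 ≤ y s / 2 := by linarith
    gcongr
  have := sq_nonneg P
  rw [abs_le] at ht hexp ⊢
  constructor <;> linarith

theorem t_bounds (hn : 1 ≤ n) (hs : ∀ i, 1 ≤ s i ∧ s i ≤ 2 ^ n)
    (ht : |t - 2 * Real.exp (y s / 2)| ≤ Del n ^ 2) : 199 / 100 ≤ t ∧ t ≤ 202 / 100 := by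
  have h := abs_t_sub_le hn hs ht
  have hP := total_le_of_one_le hn hs
  have hP0 := total_nonneg (s := s)
  have hPP : total s ^ 2 ≤ (1 / 128) ^ 2 := by gcongr
  have hw : ((1 / 2 : ℝ) ^ n) ^ 14 ≤ ((1 / 2) ^ 1) ^ 14 := by
    have := half_pow_le hn
    gcongr
  norm_num at hw hPP
  rw [abs_le] at h
  constructor <;> linarith

/-- The expansion of `1 / t` to first order, which is all that is needed: in the loss it multiplies
a quantity that varies with the ordering only by `O(P)`. -/
theorem abs_one_div_t_sub_le (hn : 1 ≤ n) (hs : ∀ i, 1 ≤ s i ∧ s i ≤ 2 ^ n)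
    (ht : |t - 2 * Real.exp (y s / 2)| ≤ Del n ^ 2) :
    |1 / t - (1 / 2 - total s / 4)| ≤ 5 / 4 * total s ^ 2 + ((1 / 2) ^ n) ^ 14 := by
  have h := abs_t_sub_le hn hs ht
  obtain ⟨ht0, ht1⟩ := t_bounds hn hs ht
  have hP := total_le_of_one_le hn hs
  have hP0 := total_nonneg (s := s)
  set P := total s
  set d : ℝ := ((1 / 2) ^ n) ^ 14
  have htpos : 0 < t := by linarith
  have e : 1 / t - (1 / 2 - P / 4) = (P ^ 2 / 4 - (t - 2 - P) * (1 / 2 - P / 4)) / t := by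
    field_simp; ring
  rw [e, abs_div, abs_of_pos htpos, div_le_iff₀ htpos]
  have h1 : |(t - 2 - P) * (1 / 2 - P / 4)| ≤ (8 / 5 * P ^ 2 + d) * (1 / 2) := by
    rw [abs_mul]
    refine mul_le_mul h ?_ (abs_nonneg _) ((abs_nonneg _).trans h)
    rw [abs_le]; constructor <;> linarith
  have h2 : |P ^ 2 / 4| = P ^ 2 / 4 := abs_of_nonneg (by positivity)
  have hd : 0 ≤ d := by positivity
  have h3 : (5 / 4 * P ^ 2 + d) * (199 / 100) ≤ (5 / 4 * P ^ 2 + d) * t := by gcongr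
  have h4 := abs_sub (P ^ 2 / 4) ((t - 2 - P) * (1 / 2 - P / 4))
  have h5 := sq_nonneg P
  linarith

theorem Gam_ge (hn : 1 ≤ n) : 256 ≤ Gam n := by
  have h : (2 : ℝ) ^ (8 * 1) ≤ 2 ^ (8 * n) := pow_le_pow_right₀ one_le_two (by omega)
  norm_num at h
  exact h

theorem denom_pos {g : ℝ} (hg : 256 ≤ g) (ht : 199 / 100 ≤ t ∧ t ≤ 202 / 100) :
    0 < 4 * t * g - 56 - 104 * t := by
  nlinarith [ht.1, ht.2]

theorem tauH_eq (n : ℕ) (t : ℝ) :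
    tauH n t = (3 * t * Gam n - 28 - 94 * t) / (4 * t * Gam n - 56 - 104 * t) := by
  rw [tauH, ← neg_div_neg_eq]
  congr 1 <;> ring

theorem three_quarters_sub_tauH (hn : 1 ≤ n) (ht : 199 / 100 ≤ t ∧ t ≤ 202 / 100) :
    2 * (1 / Gam n) ≤ 3 / 4 - tauH n t ∧ 3 / 4 - tauH n t ≤ 8 * (1 / Gam n) := by
  have hg := Gam_ge hn
  have hD := denom_pos hg ht
  have e : 3 / 4 - tauH n t = (16 * t - 14) / (4 * t * Gam n - 56 - 104 * t) := by
    rw [tauH_eq, eq_div_iff hD.ne', sub_mul, div_mul_cancel₀ _ hD.ne']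
    ring
  rw [e, mul_one_div, mul_one_div, div_le_div_iff₀ (by linarith) hD,
    div_le_div_iff₀ hD (by linarith)]
  constructor <;> nlinarith [ht.1, ht.2]

/-- The equation for which `tauH` is chosen: it makes the coefficient of the product
`∏ (1 - 2 p_i)`, over the items before box `n + 1`, equal to `coeff / t`. -/
theorem coeff_div_t (hn : 1 ≤ n) (ht : 199 / 100 ≤ t ∧ t ≤ 202 / 100) :
    -((3 / 4 - tauH n t) / 8) / 2 + 1 / Gam n / 32 + coeff n t +
      20 * (1 / Gam n) * ((3 / 4 - tauH n t) / 8) = coeff n t * (1 / t) := by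
  have hD := denom_pos (Gam_ge hn) ht
  have ht0 : t ≠ 0 := by linarith [ht.1]
  have hg := (Gam_pos n).ne'
  have hx : tauH n t * (4 * t * Gam n - 56 - 104 * t) = 3 * t * Gam n - 28 - 94 * t := by
    rw [tauH_eq, div_mul_cancel₀ _ hD.ne']
  rw [coeff]
  field_simp
  linear_combination 32 * hx

/-! ### The instance is a gadget -/

theorem tau_eq (i : Fin n) :
    tau s t i = tauH n t + 4 * coeff n t * ((s i : ℝ) / Gam n) := by
  rw [tau, coeff, tauL]; ring

theorem isGadget_inst (hn : 1 ≤ n) (hs : ∀ i, 1 ≤ s i ∧ s i ≤ 2 ^ n)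
    (ht : 199 / 100 ≤ t ∧ t ≤ 202 / 100) :
    (inst s t).IsGadget (boxL n) (boxM n) (1 / Gam n) (tauH n t) (coeff n t) := by
  have hg := Gam_ge hn
  have hg0 := Gam_pos n
  obtain ⟨hτ1, hτ2⟩ := three_quarters_sub_tauH hn ht
  have ha0 : 0 < 1 / Gam n := by positivity
  have ha : 1 / Gam n ≤ 1 / 256 := one_div_le_one_div_of_le (by norm_num) hg
  have hC : coeff n t = 7 / 8 * (1 / Gam n) * (tauH n t - 1 / 2) := rfl
  have hC0 : 0 < coeff n t := mul_pos (by positivity) (by linarith)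
  have hCa : coeff n t ≤ 1 / Gam n := by
    rw [hC, mul_comm (7 / 8) (1 / Gam n), mul_assoc]
    exact mul_le_of_le_one_right ha0.le (by linarith)
  have hp : ∀ i, 0 < (s i : ℝ) / Gam n ∧ (s i : ℝ) / Gam n ≤ 1 / 128 := fun i => by
    refine ⟨div_pos (by exact_mod_cast (hs i).1) hg0, ?_⟩
    exact (single_le_sum (f := fun i => (s i : ℝ) / Gam n)
      (fun i _ => div_nonneg (Nat.cast_nonneg _) hg0.le) (mem_univ i)).trans
      (total_le_of_one_le hn hs)
  have hτi : ∀ i, tauH n t ≤ tau s t i ∧ tau s t i ≤ 3 / 4 := fun i => by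
    rw [tau_eq]
    have h1 := mul_pos hC0 (hp i).1
    have h2 := mul_le_mul hCa (hp i).2 (hp i).1.le ha0.le
    constructor <;> linarith
  have hq : 1 - 41 / Gam n = 1 - 41 * (1 / Gam n) := by ring
  have hL : (inst s t).index (boxL n) = 1 / 2 := by
    refine Instance.index_eq rfl ?_ ?_ ?_ le_rfl (by norm_num) ?_
    · rw [prob_one, p, vec_boxL]; exact ha0
    · rw [prob_half, q, vec_boxL]; linarith
    · rw [prob_zero, p, q, vec_boxL, vec_boxL]; linarith
    · rw [prob_one, p, vec_boxL]
      change c s t (boxL n) = _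
      rw [c, vec_boxL]; ring
  have hM : (inst s t).index (boxM n) = 3 / 4 := by
    refine Instance.index_eq rfl ?_ ?_ ?_ (by norm_num) (by norm_num) ?_
    · rw [prob_one, p, vec_boxM]; norm_num
    · rw [prob_half, q, vec_boxM]; norm_num
    · rw [prob_zero, p, q, vec_boxM, vec_boxM]; norm_num
    · rw [prob_one, p, vec_boxM]
      change c s t (boxM n) = _
      rw [c, vec_boxM]; norm_num
  have hi : ∀ i, (inst s t).index (item i) = tau s t i := fun i => by
    have h1 := hp i
    have h2 := hτi i
    refine Instance.index_eq rfl ?_ ?_ ?_ (by linarith) (by linarith) ?_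
    · rw [prob_one, p, vec_item]; exact h1.1
    · rw [prob_half, q, vec_item]; exact h1.1.le
    · rw [prob_zero, p, q, vec_item, vec_item]; linarith
    · rw [prob_one, p, vec_item]
      change c s t (item i) = _
      rw [c, vec_item]
  refine
    { supp_eq := fun _ => rfl
      prob_one_pos := ?_
      prob_half_pos := ?_
      prob_zero_pos := ?_
      prob_sum := fun i => by rw [prob_zero, prob_half, prob_one]; ring
      mean_lt := ?_
      half_le_index := ?_
      index_lt_one := ?_
      cost_eq := ?_
      ne := boxL_ne_boxM
      a_pos := ha0
      half_lt := by linarith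
      C_eq := hC
      prob_one_L := by rw [prob_one, p, vec_boxL]
      prob_zero_L := by rw [prob_zero, p, q, vec_boxL, vec_boxL]; ring
      index_L := hL
      prob_one_M := by rw [prob_one, p, vec_boxM]
      prob_zero_M := by rw [prob_zero, p, q, vec_boxM, vec_boxM]; norm_num
      index_M := hM
      prob_half_item := ?_
      index_item := ?_
      index_item_le := ?_ }
  · simp only [prob_one]
    refine forall_box.2 ⟨fun i => ?_, ?_, ?_⟩
    · rw [p, vec_item]; exact (hp i).1
    · rw [p, vec_boxL]; exact ha0
    · rw [p, vec_boxM]; norm_num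
  · simp only [prob_half]
    refine forall_box.2 ⟨fun i => ?_, ?_, ?_⟩
    · rw [q, vec_item]; exact (hp i).1
    · rw [q, vec_boxL]; linarith
    · rw [q, vec_boxM]; norm_num
  · simp only [prob_zero]
    refine forall_box.2 ⟨fun i => ?_, ?_, ?_⟩
    · rw [p, q, vec_item, vec_item]; linarith [(hp i).2]
    · rw [p, q, vec_boxL, vec_boxL]; linarith
    · rw [p, q, vec_boxM, vec_boxM]; norm_num
  · intro i
    rw [Instance.mean, Instance.expect_eq_of_supp_eq rfl, prob_zero, prob_half, prob_one]
    revert i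
    refine forall_box.2 ⟨fun i => ?_, ?_, ?_⟩
    · rw [p, q, vec_item, vec_item]; linarith [(hp i).2]
    · rw [p, q, vec_boxL, vec_boxL]; linarith
    · rw [p, q, vec_boxM, vec_boxM]; norm_num
  · refine forall_box.2 ⟨fun i => ?_, hL.ge, ?_⟩
    · rw [hi]; linarith [(hτi i).1]
    · rw [hM]; norm_num
  · refine forall_box.2 ⟨fun i => ?_, ?_, ?_⟩
    · rw [hi]; linarith [(hτi i).2]
    · rw [hL]; norm_num
    · rw [hM]; norm_num
  · simp only [prob_one]
    change ∀ i, c s t i = _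
    refine forall_box.2 ⟨fun i => ?_, ?_, ?_⟩
    · rw [hi, c, p, vec_item, vec_item]
    · rw [hL, c, p, vec_boxL, vec_boxL]; ring
    · rw [hM, c, p, vec_boxM, vec_boxM]; norm_num
  · intro j hjL hjM
    obtain ⟨i, rfl⟩ := exists_item hjL hjM
    rw [prob_half, prob_one, p, q, vec_item, vec_item]
  · intro j hjL hjM
    obtain ⟨i, rfl⟩ := exists_item hjL hjM
    rw [hi, tau_eq, prob_one, p, vec_item]
  · intro j hjL hjM
    obtain ⟨i, rfl⟩ := exists_item hjL hjM
    rw [hi]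
    exact (hτi i).2

end Reduction

theorem Instance.IsRegular.isLCLRS3 {ι : Type} {I : Instance ι} (hI : I.IsRegular) :
    I.IsLCLRS3 where
  cost_nonneg i := (hI.cost_pos i).le
  value_nonneg i v hv := by
    rw [hI.supp_eq] at hv
    simp only [mem_insert, mem_singleton] at hv
    rcases hv with rfl | rfl | rfl <;> norm_num
  prob_nonneg i v hv := by
    rw [hI.supp_eq] at hv
    simp only [mem_insert, mem_singleton] at hv
    rcases hv with rfl | rfl | rfl
    exacts [(hI.prob_zero_pos i).le, (hI.prob_half_pos i).le, (hI.prob_one_pos i).le]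
  prob_sum i := by
    rw [hI.supp_eq, sum_insert (by norm_num), sum_insert (by norm_num), sum_singleton]
    linarith [hI.prob_sum i]
  supp_eq := hI.supp_eq
  prob_one_pos := hI.prob_one_pos
  cost_pos := hI.cost_pos
  mean_lt := hI.mean_lt
  half_le_index := hI.half_le_index

namespace Reduction

variable {n : ℕ} {s : Fin n → ℕ} {t : ℝ}

/-! ### Partitions of the integers and orderings of the boxes -/

/-- A single positive integer cannot be partitioned into two parts with equal sums. -/
theorem two_le_of_isYesInstance (hn : 1 ≤ n) (hs : ∀ i, 1 ≤ s i ∧ s i ≤ 2 ^ n)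
    (h : IsYesInstance s) : 2 ≤ n := by
  by_contra! hn2
  obtain rfl : n = 1 := by omega
  obtain ⟨S, hS⟩ := h
  have h0 := (hs 0).1
  rcases S.eq_empty_or_nonempty with rfl | hne
  · simp at hS; omega
  · rw [hne.eq_univ, compl_univ] at hS
    simp at hS; omega

theorem prob_one_item (i : Fin n) : (inst s t).prob (item i) 1 = 1 / Gam n * (s i : ℝ) := by
  rw [prob_one, p, vec_item]; ring

theorem sum_prob_one_item (S : Finset (Fin n)) :
    ∑ j ∈ S.map ⟨item, item_injective⟩, (inst s t).prob j 1 =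
      1 / Gam n * ((∑ i ∈ S, s i : ℕ) : ℝ) := by
  rw [sum_map, Nat.cast_sum, mul_sum]
  exact sum_congr rfl fun i _ => prob_one_item i

theorem items_eq : (univ.erase (boxL n)).erase (boxM n) =
    (univ : Finset (Fin n)).map ⟨item, item_injective⟩ := by
  ext j
  simp only [mem_erase, mem_univ, and_true, mem_map, true_and, Function.Embedding.coeFn_mk]
  constructor
  · rintro ⟨hM, hL⟩
    exact exists_item hL hM
  · rintro ⟨i, rfl⟩
    exact ⟨item_ne_boxM i, item_ne_boxL i⟩

theorem exists_map_of_subset_items {S : Finset (Fin (n + 2))}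
    (hS : S ⊆ (univ.erase (boxL n)).erase (boxM n)) :
    ∃ S' : Finset (Fin n), S = S'.map ⟨item, item_injective⟩ ∧
      (univ.erase (boxL n)).erase (boxM n) \ S = S'ᶜ.map ⟨item, item_injective⟩ := by
  rw [items_eq, subset_map_iff] at hS
  obtain ⟨S', -, rfl⟩ := hS
  exact ⟨S', rfl, by rw [items_eq, ← Finset.map_sdiff, compl_eq_univ_sdiff]⟩

/-- Two parts of the integers whose sums differ have sums that differ by at least `2` if the
integers can be partitioned into two parts with equal sums. -/
theorem two_mul_le_abs_sub (h : IsYesInstance s) {S : Finset (Fin (n + 2))}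
    (hS : S ⊆ (univ.erase (boxL n)).erase (boxM n))
    (hne : ∑ i ∈ S, (inst s t).prob i 1 ≠
      ∑ i ∈ (univ.erase (boxL n)).erase (boxM n) \ S, (inst s t).prob i 1) :
    2 * (1 / Gam n) ≤ |∑ i ∈ S, (inst s t).prob i 1 -
      ∑ i ∈ (univ.erase (boxL n)).erase (boxM n) \ S, (inst s t).prob i 1| := by
  obtain ⟨S', rfl, h2⟩ := exists_map_of_subset_items hS
  obtain ⟨Y, hY⟩ := h
  have ha : 0 < 1 / Gam n := one_div_pos.2 (Gam_pos n)
  rw [h2, sum_prob_one_item, sum_prob_one_item] at hne ⊢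
  rw [← mul_sub, abs_mul, abs_of_pos ha, mul_comm]
  refine mul_le_mul_of_nonneg_left ?_ ha.le
  have h3 := sum_add_sum_compl S' s
  have h4 := sum_add_sum_compl Y s
  set A := ∑ i ∈ S', s i
  set B := ∑ i ∈ S'ᶜ, s i
  have hAB : A ≠ B := fun h => hne (by rw [h])
  have h5 : (2 : ℤ) ≤ |(A : ℤ) - B| := by
    rcases lt_or_gt_of_ne hAB with hlt | hlt
    · rw [abs_of_neg (by omega)]; omega
    · rw [abs_of_pos (by omega)]; omega
  exact_mod_cast h5

/-- The items before and after box `n + 1` in an ordering, read off from the list of the boxes. -/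
theorem sum_bef_aft {σ : Equiv.Perm (Fin (n + 2))} {l₁ l₂ : List (Fin (n + 2))}
    (h : List.ofFn σ = l₁ ++ boxL n :: (l₂ ++ [boxM n])) :
    ∑ i ∈ bef σ, p s (item i) = (l₁.map (p s)).sum ∧
      ∑ i ∈ aft σ, p s (item i) = (l₂.map (p s)).sum := by
  have hnd : (List.ofFn σ).Nodup := List.nodup_ofFn.2 σ.injective
  have hpw : (List.ofFn σ).Pairwise fun x z => σ.symm x < σ.symm z :=
    List.pairwise_ofFn.2 fun i j hij => by simpa using hij
  have hmem : ∀ x, x ∈ List.ofFn σ := fun x => (List.mem_ofFn' _ _).2 ⟨σ.symm x, by simp⟩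
  rw [h] at hnd hpw hmem
  rw [List.pairwise_append, List.pairwise_cons] at hpw
  obtain ⟨-, ⟨hp2, -⟩, hp1⟩ := hpw
  have hb : ∀ x ∈ l₁, σ.symm x < σ.symm (boxL n) := fun x hx => hp1 x hx _ (by simp)
  have ha : ∀ x ∈ l₂, σ.symm (boxL n) < σ.symm x := fun x hx => hp2 x (by simp [hx])
  rw [List.nodup_middle, ← List.append_assoc, List.nodup_cons, List.nodup_append'] at hnd
  obtain ⟨hL, hnd, -, hM⟩ := hnd
  rw [List.disjoint_singleton] at hM
  simp only [List.mem_append, List.mem_singleton, not_or] at hL hM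
  obtain ⟨hnd₁, hnd₂, -⟩ := List.nodup_append'.1 hnd
  have hcases : ∀ i : Fin n, item i ∈ l₁ ∨ item i ∈ l₂ := fun i => by
    have := hmem (item i)
    simpa [item_ne_boxL, item_ne_boxM] using this
  have key : ∀ (l : List (Fin (n + 2))) (S : Finset (Fin n)), l.Nodup → boxL n ∉ l →
      boxM n ∉ l → (∀ i, i ∈ S ↔ item i ∈ l) →
      ∑ i ∈ S, p s (item i) = (l.map (p s)).sum := by
    intro l S hl hlL hlM hS
    have : l.toFinset = S.map ⟨item, item_injective⟩ := by
      ext j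
      simp only [List.mem_toFinset, mem_map, Function.Embedding.coeFn_mk]
      constructor
      · intro hj
        obtain ⟨i, rfl⟩ := exists_item (fun h => hlL (h ▸ hj)) (fun h => hlM (h ▸ hj))
        exact ⟨i, (hS i).2 hj, rfl⟩
      · rintro ⟨i, hi, rfl⟩
        exact (hS i).1 hi
    rw [← List.sum_toFinset _ hl, this, sum_map]
    rfl
  refine ⟨key l₁ _ hnd₁ hL.1.1 hM.1 fun i => ?_, key l₂ _ hnd₂ hL.1.2 hM.2 fun i => ?_⟩
  · rw [bef, mem_filter_univ]
    refine ⟨fun hi => (hcases i).resolve_right fun h => ?_, hb _⟩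
    exact lt_asymm hi (ha _ h)
  · rw [aft, mem_filter_univ]
    refine ⟨fun hi => (hcases i).resolve_left fun h => ?_, ha _⟩
    exact lt_asymm hi (hb _ h)

theorem isYesInstance_of_sum_eq {σ : Equiv.Perm (Fin (n + 2))}
    (h : ∑ i ∈ aft σ, p s (item i) = ∑ i ∈ bef σ, p s (item i)) : IsYesInstance s := by
  refine ⟨aft σ, ?_⟩
  have hc : (aft σ)ᶜ = bef σ := by
    ext i
    have hne : σ.symm (item i) ≠ σ.symm (boxL n) := fun h => item_ne_boxL i (σ.symm.injective h)
    simp only [aft, bef, mem_compl, mem_filter_univ, not_lt]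
    exact ⟨fun h => lt_of_le_of_ne h hne, le_of_lt⟩
  simp only [p, vec_item] at h
  rw [← sum_div, ← sum_div, div_left_inj' (Gam_pos n).ne'] at h
  rw [hc]
  exact_mod_cast h

/-- If the integers can be partitioned into two parts with equal sums, then an optimal ordering
realizes such a partition. -/
theorem sum_aft_eq_sum_bef (hn : 1 ≤ n) (hs : ∀ i, 1 ≤ s i ∧ s i ≤ 2 ^ n)
    (ht : |t - 2 * Real.exp (y s / 2)| ≤ Del n ^ 2) (hyes : IsYesInstance s)
    {A : Policy (univ : Finset (Fin (n + 2)))} (hA : A.IsOptimal (inst s t))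
    {σ : Equiv.Perm (Fin (n + 2))} (hσ : A.IsNormal (inst s t) σ) :
    ∑ i ∈ aft σ, p s (item i) = ∑ i ∈ bef σ, p s (item i) := by
  have hn2 := two_le_of_isYesInstance hn hs hyes
  have htb := t_bounds hn hs ht
  have hG := isGadget_inst hn hs htb
  obtain ⟨hτ1, hτ2⟩ := three_quarters_sub_tauH hn htb
  have hu := abs_one_div_t_sub_le hn hs ht
  have hP := total_le hn hs
  have hP0 := total_nonneg (s := s)
  have hsum : ∑ i ∈ (univ.erase (boxL n)).erase (boxM n), (inst s t).prob i 1 = total s := by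
    rw [items_eq, sum_map]
    exact sum_congr rfl fun i _ => (prob_one_item i).trans (by ring)
  -- All the parameters are bounded in terms of `w = 2⁻ⁿ ≤ 1/4`.
  have ha := Gam_eq n
  have hw : (1 / 2 : ℝ) ^ n ≤ 1 / 4 := (half_pow_le hn2).trans (by norm_num)
  have hw0 : (0 : ℝ) < (1 / 2) ^ n := by positivity
  have hCa : coeff n t ≤ 1 / Gam n := by
    have h : 0 < 1 / Gam n := one_div_pos.2 (Gam_pos n)
    rw [coeff, mul_comm (7 / 8) (1 / Gam n), mul_assoc]
    exact mul_le_of_le_one_right h.le (by linarith)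
  set w : ℝ := (1 / 2) ^ n
  have hw2 : w ^ 2 ≤ (1 / 4) ^ 2 := by gcongr
  have hw4 : w ^ 4 ≤ (1 / 4) ^ 4 := by gcongr
  have hw6 : w ^ 6 ≤ (1 / 4) ^ 6 := by gcongr
  have hw8 : w ^ 8 ≤ (1 / 4) ^ 8 := by gcongr
  norm_num at hw2 hw4 hw6 hw8
  have hw16 : 0 < w ^ 16 := by positivity
  have b1 : total s ^ 3 ≤ (w ^ 6 / 2) ^ 3 := by gcongr
  have b2 : w ^ 8 * total s ^ 2 ≤ w ^ 8 * (w ^ 6 / 2) ^ 2 := by gcongr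
  have b3 : total s * w ^ 14 ≤ w ^ 6 / 2 * w ^ 14 := by gcongr
  have b4 := mul_le_mul_of_nonneg_left hw2 hw16.le
  have b5 := mul_le_mul_of_nonneg_left hw4 hw16.le
  obtain ⟨Y, hY⟩ := hyes
  have hne : List.ofFn σ ≠ [] := by simp
  have hnd : (List.ofFn σ).Nodup := List.nodup_ofFn.2 σ.injective
  have hσu : (List.ofFn σ).toFinset = univ := eq_univ_of_forall fun x =>
    List.mem_toFinset.2 ((List.mem_ofFn' _ _).2 ⟨σ.symm x, by simp⟩)
  obtain ⟨l₁, l₂, hl, h12⟩ := hG.sum_eq_of_loss_minimal (d := w ^ 14) hsum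
    (coeff_div_t hn htb) hCa
    (by have := one_div_pos.2 (Gam_pos n); linarith) hτ2 (by rw [ha]; linarith) hu (by linarith)
    (by rw [ha]; linarith) (by rw [ha]; linarith) (by rw [ha]; linarith)
    (fun S hS h => two_mul_le_abs_sub ⟨Y, hY⟩ hS h)
    ⟨Y.map ⟨item, item_injective⟩, by rw [items_eq]; exact map_subset_map.2 (subset_univ Y), by
      rw [items_eq, ← Finset.map_sdiff, ← compl_eq_univ_sdiff, sum_prob_one_item,
        sum_prob_one_item, hY]⟩
    hnd hσu fun l' h1 h2 h3 => hG.toIsRegular.loss_le_of_isOptimal hA hnd hσu hσ h1 h2 h3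
  obtain ⟨hb, haft⟩ := sum_bef_aft (s := s) hl
  simp only [prob_one] at h12
  rw [hb, haft]
  exact h12.symm

end Reduction

end PandoraNOI

end

theorem mainTheorem6 (n : ℕ) (hn : 1 ≤ n) (s : Fin n → ℕ) (hs : ∀ i, 1 ≤ s i ∧ s i ≤ 2 ^ n)
    (t : ℝ) (ht : |t - 2 * Real.exp (PandoraNOI.Reduction.y s / 2)| ≤ PandoraNOI.Reduction.Del n ^ 2) :
    (PandoraNOI.Reduction.inst s t).IsLCLRS3 ∧
    (∃ A : PandoraNOI.Policy (Finset.univ : Finset (Fin (n + 2))),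
      A.IsOptimal (PandoraNOI.Reduction.inst s t)) ∧
    ∀ A : PandoraNOI.Policy (Finset.univ : Finset (Fin (n + 2))),
      A.IsOptimal (PandoraNOI.Reduction.inst s t) →
      (∃ σ : Equiv.Perm (Fin (n + 2)), A.IsNormal (PandoraNOI.Reduction.inst s t) σ) ∧
      ∀ σ : Equiv.Perm (Fin (n + 2)), A.IsNormal (PandoraNOI.Reduction.inst s t) σ →
        (PandoraNOI.IsYesInstance s ↔
          ∑ i ∈ PandoraNOI.Reduction.aft σ,
              PandoraNOI.Reduction.p s (PandoraNOI.Reduction.item i) =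
            ∑ i ∈ PandoraNOI.Reduction.bef σ,
              PandoraNOI.Reduction.p s (PandoraNOI.Reduction.item i)) := by
  have hR := (PandoraNOI.Reduction.isGadget_inst hn hs
    (PandoraNOI.Reduction.t_bounds hn hs ht)).toIsRegular
  refine ⟨hR.isLCLRS3, hR.exists_payoffFrom_max _ 0, fun A hA =>
    ⟨hR.exists_isNormal (by omega) A hA, fun σ hσ => ⟨fun hyes => ?_, fun h => ?_⟩⟩⟩
  · exact PandoraNOI.Reduction.sum_aft_eq_sum_bef hn hs ht hyes hA hσ
  · exact PandoraNOI.Reduction.isYesInstance_of_sum_eq h
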